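/- **Lemma 1.** *Channel model.* Users are indexed by $l$; user $l$ has finitely many rays $r=(c,s)$ ($1\le c\le C$, $1\le s\le S$) with deterministic powers $\beta^{(l)}_r\ge 0$, phases $\Theta^{(l)}_r\sim\mathcal U[0,2\pi]$, azimuth angles $\phi^{(l)}_r$ and elevation angles $\theta^{(l)}_r$, the latter measured from the $z$-axis, and channel vector $\mathbf h_l=\sum_r\sqrt{\beta^{(l)}_r}\,e^{j\Theta^{(l)}_r}\,\mathbf a(\phi^{(l)}_r,\theta^{(l)}_r)\in\mathbb C^M$, where $\mathbf a$ is the steering vector of the array. The phases are mutually independent and jointly independent of the angles. All azimuth angles have the same law; all elevation angles have the same law, which has a density and is supported in $[0,\pi]$. For any ray of one user and any ray of another user, the two azimuths and two elevations are mutually independent. Put $\beta^{(l)}=\sum_r\beta^{(l)}_r$. For $l\ne l'$ with $\beta^{(l)},\beta^{(l')}>0$ the normalised mean interference is $$\kappa=\frac{\mathbb E\,|\mathbf h_l^{\mathrm H}\mathbf h_{l'}|^2}{M^2\beta^{(l)}\beta^{(l')}} .$$ *Arrays.* Number antennas from $0$. The uniform cylindrical array (UCylA) with $M_r\ge2$,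 $M_z\ge1$, $M=M_rM_z$ has $$\mathbf a(\phi,\theta)_{(m_r,m_z)}=e^{j\frac{\pi d_r}{\sin(\pi/M_r)}\sin\theta\cos(\phi-\Psi_{m_r})}\,e^{j2\pi d_zm_z\cos\theta},\qquad \Psi_m=2\pi m/M_r .$$ The vertical uniform rectangular array (VURA) with $M_y,M_z\ge1$, $M=M_yM_z$ has $$\mathbf a(\phi,\theta)_{(m_y,m_z)}=e^{j2\pi d_ym_y\sin\theta\sin\phi}\,e^{j2\pi d_zm_z\cos\theta}.$$ *Series.* Let $\psi(n)=\mathbb E[e^{jn\phi}]$ be the characteristic function of the azimuth and $\chi(n)=\mathbb E[e^{jn(\theta-\pi/2)}]$ that of the elevation relative to broadside $\theta=\pi/2$. Let $p(n)=\min(n,0)$, let $J_\nu$ be the Bessel function of the first kind, and for real $A,z_1,z_2$ let $$V(A,z_1,z_2)=\sum_{n=-\infty}^{\infty}(-1)^{p(n)}e^{jnA}\psi(n)\sum_{n'=-\infty}^{\infty}\chi(2n')\sum_{\hat n=-\infty}^{\infty}J_{\frac{|n|}2-\hat n}\!\left(\tfrac{z_1}2\right)J_{\frac{|n|}2+\hat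 n}\!\left(\tfrac{z_1}2\right)G(n,n',\hat n,z_2),$$ $$G(n,n',\hat n,z_2)=J_{2(n'+\hat n)}(z_2)+\frac4\pi\sum_{\hat n'=1}^{\infty}(-1)^{\hat n'-n'-\hat n}\,\frac{J_{2\hat n'-1}(z_2)\,2(n'+\hat n)}{(2\hat n'-1)^2-4(n'+\hat n)^2}.$$ Here the sum over $n'$ is the limit of its symmetric partial sums $\sum_{|n'|\le N}$, the principal branch of $(z/2)^\nu$ is used in $J_\nu(z)$, and for $z_1=0$ the product of the two Bessel functions is read as its limit as $z_1\to0$. *Claim.* For all real $A,z_1,z_2$ all these series converge (those over $n$, $\hat n$ and $\hat n'$ absolutely). For the UCylA, with any real $d_r,d_z$, the expectation in $\kappa$ is finite and $$\kappa^{\mathrm{UCylA}}=\frac1{M^2}\sum_{m_r,m_r'=0}^{M_r-1}\ \sum_{m_z,m_z'=0}^{M_z-1}|V(A,z_1,z_2)|^2,$$ where $a=\sin\Psi_{m_r}-\sin\Psi_{m_r'}$, $b=\cos\Psi_{m_r}-\cos\Psi_{m_r'}$, $A=\arctan(b/a)$ (with $A=\pm\pi/2$, the sign being that of $b$, if $a=0\ne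 b$, and $A=0$ if $a=b=0$), $z_1=\sqrt{a^2+b^2}\,\pi d_r/\sin(\pi/M_r)$ and $z_2=2\pi d_z(m_z-m_z')$. For the VURA, with any real $d_y,d_z$, the expectation in $\kappa$ is finite and $$\kappa^{\mathrm{VURA}}=\frac1{M^2}\sum_{m_y,m_y'=0}^{M_y-1}\ \sum_{m_z,m_z'=0}^{M_z-1}|V(0,z_1,z_2)|^2,\qquad z_1=2\pi d_y(m_y-m_y'),\quad z_2=2\pi d_z(m_z-m_z').$$ -/

import Mathlib

open MeasureTheory ProbabilityTheory SummationFilter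

/-- The Bessel function of the first kind `J_ν(z)` of real order `ν`, by its power series, with the
principal branch of `(z/2)^ν`. At the poles of `Γ` Mathlib has `Γ = 0`, hence `1 / Γ = 0` as it
should be, so that negative integer orders are covered. -/
noncomputable def besselJ (ν : ℝ) (z : ℂ) : ℂ :=
  (z / 2) ^ (ν : ℂ) *
    ∑' m : ℕ, (-1) ^ m / ((Nat.factorial m : ℂ) * Complex.Gamma (m + ν + 1)) * (z / 2) ^ (2 * m)

/-- A ray-based channel model for `L` users, each with `C` scattering clusters of `S` subrays; a ray
of a user is indexed by `(c, s) : Fin C × Fin S`. The azimuth angles of arrival have the common law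
`μ` and the elevation angles of arrival (measured from the `z`-axis) the common law `ν`.
Angles of different rays of one user may be dependent (as they are when the rays of a cluster share
a random central angle); the angles of a ray of one user and of a ray of another user are
independent. -/
structure RayModel {Ω : Type*} [MeasurableSpace Ω] (P : Measure Ω) (μ ν : Measure ℝ)
    (L C S : ℕ) where
  /-- ray powers -/
  power : Fin L → Fin C × Fin S → ℝ
  /-- ray phases -/
  phase : Fin L → Fin C × Fin S → Ω → ℝ
  /-- azimuth angles of arrival -/
  azimuth : Fin L → Fin C × Fin S → Ω → ℝ
  /-- elevation angles of arrival -/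
  elevation : Fin L → Fin C × Fin S → Ω → ℝ
  power_nonneg : ∀ l r, 0 ≤ power l r
  measurable_phase : ∀ l r, Measurable (phase l r)
  measurable_azimuth : ∀ l r, Measurable (azimuth l r)
  measurable_elevation : ∀ l r, Measurable (elevation l r)
  phase_uniform : ∀ l r, pdf.IsUniform (phase l r) (Set.Icc 0 (2 * Real.pi)) P volume
  azimuth_law : ∀ l r, P.map (azimuth l r) = μ
  elevation_law : ∀ l r, P.map (elevation l r) = ν
  phase_iIndep : iIndepFun (fun q : Fin L × (Fin C × Fin S) => phase q.1 q.2) P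
  phase_indep_angles :
    IndepFun (fun ω (q : Fin L × (Fin C × Fin S)) => phase q.1 q.2 ω)
      (fun ω (q : Fin L × (Fin C × Fin S)) => (azimuth q.1 q.2 ω, elevation q.1 q.2 ω)) P
  angles_iIndep : ∀ l l', l ≠ l' → ∀ r r',
    iIndepFun ![azimuth l r, elevation l r, azimuth l' r', elevation l' r'] P

namespace RayModel

variable {Ω : Type*} [MeasurableSpace Ω] {P : Measure Ω} {μ ν : Measure ℝ} {L C S : ℕ}

/-- The total link gain `β^{(l)}` of user `l`. -/
def gain (R : RayModel P μ ν L C S) (l : Fin L) : ℝ := ∑ r, R.power l r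

/-- The channel vector `h_l = ∑_r √β_r e^{jΘ_r} a(φ_r, θ_r)` of user `l`, for the steering vector
`a : (azimuth) → (elevation) → (antenna) → ℂ`. -/
noncomputable def channel {ι : Type*} (R : RayModel P μ ν L C S) (a : ℝ → ℝ → ι → ℂ)
    (l : Fin L) (ω : Ω) : ι → ℂ := fun m =>
  ∑ r, (Real.sqrt (R.power l r) : ℂ) * Complex.exp (Complex.I * R.phase l r ω) *
    a (R.azimuth l r ω) (R.elevation l r ω) m

/-- The interference power `|h_lᴴ h_{l'}|²`. -/
noncomputable def interference {ι : Type*} [Fintype ι] (R : RayModel P μ ν L C S)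
    (a : ℝ → ℝ → ι → ℂ) (l l' : Fin L) (ω : Ω) : ℝ :=
  ‖star (R.channel a l ω) ⬝ᵥ R.channel a l' ω‖ ^ 2

/-- The normalised mean interference `κ = E|h_lᴴ h_{l'}|² / (M² β^{(l)} β^{(l')})`, where `M` is the
number of antennas. -/
noncomputable def nmi {ι : Type*} [Fintype ι] (R : RayModel P μ ν L C S)
    (a : ℝ → ℝ → ι → ℂ) (l l' : Fin L) : ℝ :=
  (∫ ω, R.interference a l l' ω ∂P) / ((Fintype.card ι : ℝ) ^ 2 * R.gain l * R.gain l')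

end RayModel

/-- The angular position `Ψ_m = 2πm/M_r` of antenna `m` on the circle. -/
noncomputable def circAngle (Mr : ℕ) (m : Fin Mr) : ℝ := 2 * Real.pi * (m : ℕ) / Mr

/-- Steering vector of a uniform circular array. -/
noncomputable def steerCirc (Mr : ℕ) (dr φ θ : ℝ) (m : Fin Mr) : ℂ :=
  Complex.exp (Complex.I *
    (Real.pi * dr / Real.sin (Real.pi / Mr) * Real.sin θ * Real.cos (φ - circAngle Mr m) : ℝ))

/-- Steering vector of a uniform linear array along the `y`-axis (antennas numbered from `0`). -/
noncomputable def steerY (My : ℕ) (dy φ θ : ℝ) (m : Fin My) : ℂ :=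
  Complex.exp (Complex.I * (2 * Real.pi * dy * (m : ℕ) * Real.sin θ * Real.sin φ : ℝ))

/-- Steering vector of a uniform linear array along the `z`-axis (antennas numbered from `0`). -/
noncomputable def steerZ (Mz : ℕ) (dz θ : ℝ) (m : Fin Mz) : ℂ :=
  Complex.exp (Complex.I * (2 * Real.pi * dz * (m : ℕ) * Real.cos θ : ℝ))

/-- Steering vector of the uniform cylindrical array, the Kronecker product `a_r ⊗ a_z`. -/
noncomputable def steerUCylA (Mr Mz : ℕ) (dr dz φ θ : ℝ) (m : Fin Mr × Fin Mz) : ℂ :=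
  steerCirc Mr dr φ θ m.1 * steerZ Mz dz θ m.2

/-- Steering vector of the vertical uniform rectangular array, the Kronecker product
`a_y ⊗ a_z`. -/
noncomputable def steerVURA (My Mz : ℕ) (dy dz φ θ : ℝ) (m : Fin My × Fin Mz) : ℂ :=
  steerY My dy φ θ m.1 * steerZ Mz dz θ m.2

/-- `ψ(n) = E e^{jnφ}`, the characteristic function of the azimuth. -/
noncomputable def psiCF (μ : Measure ℝ) (n : ℤ) : ℂ := charFun μ (n : ℝ)

/-- `χ(n) = E e^{jn(θ - π/2)}`, the characteristic function of the elevation, relative to the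
broadside direction `θ = π/2`. -/
noncomputable def chiCF (ν : Measure ℝ) (n : ℤ) : ℂ :=
  charFun (ν.map fun θ => θ - Real.pi / 2) (n : ℝ)

/-- The summand of index `k` of the series in `G(n, n', n̂, z₂)`; here `n₁ = n'` and `n₂ = n̂`. -/
noncomputable def gTerm (n₁ n₂ : ℤ) (z₂ : ℝ) (k : ℕ+) : ℂ :=
  (-1) ^ ((k : ℤ) - n₁ - n₂) *
    (besselJ (2 * (k : ℕ) - 1) z₂ * (2 * (n₁ + n₂)) /
      ((2 * (k : ℕ) - 1) ^ 2 - 4 * (n₁ + n₂) ^ 2))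

/-- `G(n, n', n̂, z₂)` with `n₁ = n'` and `n₂ = n̂`; it does not depend on `n`. -/
noncomputable def gFun (n₁ n₂ : ℤ) (z₂ : ℝ) : ℂ :=
  besselJ (2 * (n₁ + n₂)) z₂ + 4 / Real.pi * ∑' k : ℕ+, gTerm n₁ n₂ z₂ k

/-- `J_{|n|/2-n̂}(z₁/2) J_{|n|/2+n̂}(z₁/2) G(n, n', n̂, z₂)`. For odd `n` and `z₁ = 0`, where one of
the two Bessel factors may be singular, the value is `0`, the limit of the product as `z₁ → 0`,
since `0 ^ s = 0` for `s ≠ 0`. -/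
noncomputable def vTerm (n n₁ n₂ : ℤ) (z₁ z₂ : ℝ) : ℂ :=
  besselJ (|(n : ℝ)| / 2 - n₂) (z₁ / 2) * besselJ (|(n : ℝ)| / 2 + n₂) (z₁ / 2) * gFun n₁ n₂ z₂

/-- The term of index `n'` of the middle series in `V`. -/
noncomputable def vMid (ν : Measure ℝ) (n n₁ : ℤ) (z₁ z₂ : ℝ) : ℂ :=
  chiCF ν (2 * n₁) * ∑' n₂ : ℤ, vTerm n n₁ n₂ z₁ z₂

/-- The term of index `n` of the outer series in `V`. The middle series, over `n'`, is the limit of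
the symmetric partial sums, as usual for Fourier series. -/
noncomputable def vOut (μ ν : Measure ℝ) (n : ℤ) (A z₁ z₂ : ℝ) : ℂ :=
  (-1) ^ (min n 0) * Complex.exp (Complex.I * n * A) * psiCF μ n *
    ∑'[symmetricIcc ℤ] n₁ : ℤ, vMid ν n n₁ z₁ z₂

/-- The triple series `V(A, z₁, z₂)`. -/
noncomputable def vSeries (μ ν : Measure ℝ) (A z₁ z₂ : ℝ) : ℂ := ∑' n : ℤ, vOut μ ν n A z₁ z₂

/-- All the series in the definition of `V(A, z₁, z₂)` converge. -/
def VConverges (μ ν : Measure ℝ) (A z₁ z₂ : ℝ) : Prop :=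
  (∀ n₁ n₂ : ℤ, Summable (gTerm n₁ n₂ z₂)) ∧
  (∀ n n₁ : ℤ, Summable fun n₂ : ℤ => vTerm n n₁ n₂ z₁ z₂) ∧
  (∀ n : ℤ, Summable (fun n₁ : ℤ => vMid ν n n₁ z₁ z₂) (symmetricIcc ℤ)) ∧
  Summable fun n : ℤ => vOut μ ν n A z₁ z₂

/-- `a = sin Ψ_m - sin Ψ_{m'}`. -/
noncomputable def cylS (Mr : ℕ) (m m' : Fin Mr) : ℝ :=
  Real.sin (circAngle Mr m) - Real.sin (circAngle Mr m')

/-- `b = cos Ψ_m - cos Ψ_{m'}`. -/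
noncomputable def cylC (Mr : ℕ) (m m' : Fin Mr) : ℝ :=
  Real.cos (circAngle Mr m) - Real.cos (circAngle Mr m')

/-- `arctan (b / a)`, with the value `± π/2` (the sign being that of `b`) for `a = 0 ≠ b`, and `0`
for `a = b = 0`. -/
noncomputable def arctanQuot (b a : ℝ) : ℝ :=
  if a = 0 then (SignType.sign b : ℝ) * (Real.pi / 2) else Real.arctan (b / a)

/-- The parameter `A` of the cylindrical array. -/
noncomputable def cylA (Mr : ℕ) (m m' : Fin Mr) : ℝ := arctanQuot (cylC Mr m m') (cylS Mr m m')

/-- The parameter `z₁` of the cylindrical array. -/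
noncomputable def cylZ₁ (Mr : ℕ) (dr : ℝ) (m m' : Fin Mr) : ℝ :=
  Real.sqrt (cylS Mr m m' ^ 2 + cylC Mr m m' ^ 2) * Real.pi * dr / Real.sin (Real.pi / Mr)

/-- The parameter `2πd(m - m')` of a linear array with spacing `d`. -/
noncomputable def linZ {N : ℕ} (d : ℝ) (m m' : Fin N) : ℝ :=
  2 * Real.pi * d * (((m : ℕ) : ℝ) - ((m' : ℕ) : ℝ))

/-! The phases reduce everything to antenna correlations. Expanding the interference over pairs of
rays, distinct pairs are uncorrelated because the phases are independent, uniform and independent of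
the angles, so only the diagonal survives. There the two directions are independent with the same
law, which gives `RayModel.nmi_eq`: the mean interference is the sum of the squared moduli of the
antenna correlations, scaled by the gains. For both arrays a correlation is, up to conjugation, the
mean of `pairResponse`, that is of e^{j(z₁ sin θ sin(φ+A) + z₂ cos θ)}.

It remains to show that V is this mean (`vSeries_eq_integral`). The Jacobi–Anger expansion in φ + A
(`hasSum_besselInt_exp`) separates azimuth from elevation and produces the sum over n with the
factor ψ(n). With t = θ - π/2 in [-π/2, π/2], the elevation part is F(t) = J_{|n|}(z₁ cos t) e^{-j
z₂ sin t}. Its Fourier series of period π produces the sum over n', since e^{2jn't} has mean χ(2n').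

The Fourier coefficients of F are convolutions of those of its two factors, which is the sum over
n̂. The Bessel factor has coefficients J_{|n|/2-n̂} J_{|n|/2+n̂} by Neumann's integral
(`besselJ_mul_besselJ`), and the exponential has coefficients G (`gFun_eq`), found by applying
Jacobi–Anger once more.

The delicate point is the sum over n': F may have different values at ±π/2, so its coefficients need
not be summable. Subtracting a linear function removes the jump, and the sawtooth series has
uniformly bounded symmetric partial sums. Hence the partial sums converge boundedly on the open
interval (`fourier_bounded_convergence`). The end points are null for a law with a density, so
dominated convergence applies. -/

/-! ### Bessel functions of integer order -/

/-- The `m`-th term of the power series of the Bessel function of order `n : ℕ`. -/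
noncomputable def besselNatTerm (n : ℕ) (z : ℂ) (m : ℕ) : ℂ :=
  (-1) ^ m / ((Nat.factorial m : ℂ) * (Nat.factorial (m + n) : ℂ)) * (z / 2) ^ (2 * m + n)

/-- The Bessel function of the first kind of order `n : ℕ`. -/
noncomputable def besselNat (n : ℕ) (z : ℂ) : ℂ := ∑' m : ℕ, besselNatTerm n z m

/-- Bounding (m+n)! below by n! still leaves an exponential series in m, and the factor |z/2|^n/n!
is summable over n. This serves all later dominations. -/
theorem norm_besselNatTerm_le (n : ℕ) (z : ℂ) (m : ℕ) :
    ‖besselNatTerm n z m‖ ≤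
      ‖z / 2‖ ^ n / (Nat.factorial n : ℝ) * ((‖z / 2‖ ^ 2) ^ m / (Nat.factorial m : ℝ)) := by
  have h1 : ‖besselNatTerm n z m‖ =
      ‖z / 2‖ ^ n * (‖z / 2‖ ^ 2) ^ m / ((Nat.factorial m : ℝ) * (Nat.factorial (m + n) : ℝ)) := by
    simp only [besselNatTerm, norm_mul, norm_div, norm_pow, norm_neg, norm_one, one_pow,
      Complex.norm_natCast]
    ring
  rw [h1, div_mul_div_comm, mul_comm (Nat.factorial n : ℝ)]
  have : (Nat.factorial n : ℝ) ≤ Nat.factorial (m + n) := by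
    exact_mod_cast Nat.factorial_le (Nat.le_add_left n m)
  gcongr

theorem summable_besselNatTerm_bound (n : ℕ) (x : ℝ) :
    Summable fun m : ℕ => x ^ n / (Nat.factorial n : ℝ) *
      ((x ^ 2) ^ m / (Nat.factorial m : ℝ)) :=
  (Real.summable_pow_div_factorial _).mul_left _

theorem summable_norm_besselNatTerm (n : ℕ) (z : ℂ) : Summable fun m => ‖besselNatTerm n z m‖ :=
  (summable_besselNatTerm_bound n ‖z / 2‖).of_nonneg_of_le (fun _ => norm_nonneg _)
    (norm_besselNatTerm_le n z)

theorem hasSum_besselNatTerm (n : ℕ) (z : ℂ) : HasSum (besselNatTerm n z) (besselNat n z) :=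
  (summable_norm_besselNatTerm n z).of_norm.hasSum

theorem norm_besselNat_le (n : ℕ) (z : ℂ) :
    ‖besselNat n z‖ ≤ ‖z / 2‖ ^ n / (Nat.factorial n : ℝ) * Real.exp (‖z / 2‖ ^ 2) := by
  have h : HasSum (fun m : ℕ => ‖z / 2‖ ^ n / (Nat.factorial n : ℝ) *
      ((‖z / 2‖ ^ 2) ^ m / (Nat.factorial m : ℝ)))
      (‖z / 2‖ ^ n / (Nat.factorial n : ℝ) * Real.exp (‖z / 2‖ ^ 2)) := by
    rw [Real.exp_eq_exp_ℝ]
    exact (NormedSpace.expSeries_div_hasSum_exp (‖z / 2‖ ^ 2)).mul_left _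
  exact tsum_of_norm_bounded h (norm_besselNatTerm_le n z)

theorem differentiable_besselNat (n : ℕ) : Differentiable ℂ (besselNat n) := by
  intro z
  have hU : IsOpen (Metric.ball (0 : ℂ) (‖z‖ + 1)) := Metric.isOpen_ball
  have hd : DifferentiableOn ℂ (fun w => ∑' m, besselNatTerm n w m)
      (Metric.ball (0 : ℂ) (‖z‖ + 1)) := by
    refine Complex.differentiableOn_tsum_of_summable_norm
      (summable_besselNatTerm_bound n ((‖z‖ + 1) / 2)) (fun m => ?_) hU (fun m w hw => ?_)
    · unfold besselNatTerm
      fun_prop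
    · refine (norm_besselNatTerm_le n w m).trans ?_
      have : ‖w / 2‖ ≤ (‖z‖ + 1) / 2 := by
        rw [norm_div, Complex.norm_ofNat]
        have := (mem_ball_zero_iff.1 hw).le
        gcongr
      gcongr
  exact hd.differentiableAt (hU.mem_nhds (by simp))

theorem besselNat_zero_arg (n : ℕ) : besselNat n 0 = if n = 0 then 1 else 0 := by
  unfold besselNat
  rw [tsum_eq_single 0]
  · by_cases h : n = 0 <;> simp [besselNatTerm, h]
  · intro m hm
    simp [besselNatTerm, hm]

theorem besselJ_natCast (n : ℕ) (z : ℂ) : besselJ (n : ℝ) z = besselNat n z := by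
  unfold besselJ besselNat
  rw [← tsum_mul_left]
  congr 1
  ext m
  have : Complex.Gamma (m + ((n : ℝ) : ℂ) + 1) = (Nat.factorial (m + n) : ℂ) := by
    rw [← Complex.Gamma_nat_eq_factorial]; push_cast; rfl
  rw [this, Complex.ofReal_natCast, Complex.cpow_natCast, besselNatTerm, pow_add]
  ring

/-- The reciprocal of Γ vanishes at its poles, so the first n terms drop out; shifting the index by
n gives the series of order n. -/
theorem besselJ_neg_natCast (n : ℕ) (z : ℂ) :
    besselJ (-(n : ℝ)) z = (-1) ^ n * besselNat n z := by
  rcases eq_or_ne z 0 with rfl | hz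
  · rw [besselNat_zero_arg]
    rcases Nat.eq_zero_or_pos n with rfl | hn
    · have := besselJ_natCast 0 0
      rw [besselNat_zero_arg] at this
      simpa using this
    -- At the origin `0 ^ (-n) = 0` in Lean, which agrees with the true value 0.
    · simp [besselJ, hn.ne']
  have hz2 : z / 2 ≠ 0 := by simpa using hz
  unfold besselJ
  set f : ℕ → ℂ := fun m => (-1) ^ m / ((Nat.factorial m : ℂ) *
    Complex.Gamma (m + ((-(n : ℝ) : ℝ) : ℂ) + 1)) * (z / 2) ^ (2 * m) with hf
  have hzero : ∀ m < n, f m = 0 := by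
    intro m hm
    obtain ⟨d, rfl⟩ : ∃ d, n = m + 1 + d := ⟨n - (m + 1), by omega⟩
    have : Complex.Gamma (m + ((-((m + 1 + d : ℕ) : ℝ) : ℝ) : ℂ) + 1) = 0 := by
      rw [← Complex.Gamma_neg_nat_eq_zero d]; congr 1; push_cast; ring
    simp only [hf, this]; simp
  have hshift : ∑' m, f m = ∑' m, f (m + n) := by
    symm
    refine (add_left_injective n).tsum_eq (f := f) ?_
    intro m hm
    by_contra hcon
    refine hm (hzero m ?_)
    by_contra hlt
    exact hcon ⟨m - n, by simp; omega⟩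
  rw [hshift, ← tsum_mul_left, besselNat, ← tsum_mul_left]
  congr 1
  ext m
  have hG : Complex.Gamma (((m + n : ℕ) : ℂ) + ((-(n : ℝ) : ℝ) : ℂ) + 1) =
      (Nat.factorial m : ℂ) := by
    rw [← Complex.Gamma_nat_eq_factorial]; congr 1; push_cast; ring
  simp only [hf, hG, besselNatTerm]
  rw [Complex.ofReal_neg, Complex.ofReal_natCast, Complex.cpow_neg, Complex.cpow_natCast]
  have h1 : (z / 2) ^ (2 * (m + n)) = (z / 2) ^ n * (z / 2) ^ (2 * m + n) := by
    rw [← pow_add]; congr 1; ring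
  rw [h1, pow_add (-1 : ℂ)]
  field_simp

theorem besselJ_even_intCast (k : ℤ) (z : ℂ) :
    besselJ (2 * (k : ℝ)) z = besselNat (2 * k).natAbs z := by
  obtain ⟨n, rfl | rfl⟩ := k.eq_nat_or_neg
  · have := besselJ_natCast (2 * n) z
    rw [show (2 * (n : ℤ)).natAbs = 2 * n by omega, ← this]
    push_cast; rfl
  · have := besselJ_neg_natCast (2 * n) z
    rw [show (2 * -(n : ℤ)).natAbs = 2 * n by omega]
    rw [pow_mul, neg_one_sq, one_pow, one_mul] at this
    rw [← this]
    push_cast; congr 1; ring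

/-- The Bessel function of integer order. -/
noncomputable def besselInt (n : ℤ) (z : ℂ) : ℂ := (-1) ^ (min n 0) * besselNat n.natAbs z

theorem norm_besselInt (n : ℤ) (z : ℂ) : ‖besselInt n z‖ = ‖besselNat n.natAbs z‖ := by
  simp [besselInt]

/-! ### The Jacobi–Anger expansion -/

/-- Pairs of naturals by their difference and their minimum. -/
def diffMinEquiv : ℤ × ℕ ≃ ℕ × ℕ where
  toFun q := (q.2 + q.1.toNat, q.2 + (-q.1).toNat)
  invFun q := ((q.1 : ℤ) - q.2, min q.1 q.2)
  left_inv := by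
    rintro ⟨n, m⟩
    ext <;> simp <;> omega
  right_inv := by rintro ⟨n, m⟩; ext <;> simp <;> omega

theorem expTerm_mul_expTerm_diffMinEquiv (z t : ℂ) (ht : t ≠ 0) (n : ℤ) (m : ℕ) :
    (z / 2 * t) ^ (m + n.toNat) / (Nat.factorial (m + n.toNat) : ℂ) *
      ((-(z / 2) * t⁻¹) ^ (m + (-n).toNat) / (Nat.factorial (m + (-n).toNat) : ℂ)) =
    (-1 : ℂ) ^ (min n 0) * t ^ n * besselNatTerm n.natAbs z m := by
  unfold besselNatTerm
  have hm : (Nat.factorial m : ℂ) ≠ 0 := Nat.cast_ne_zero.2 (Nat.factorial_ne_zero _)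
  obtain ⟨k, rfl | rfl⟩ := n.eq_nat_or_neg
  · have h1 : min (k : ℤ) 0 = 0 := by omega
    have h2 : (-(k : ℤ)).toNat = 0 := by omega
    have hk : (Nat.factorial (m + k) : ℂ) ≠ 0 := Nat.cast_ne_zero.2 (Nat.factorial_ne_zero _)
    simp only [h1, h2, Int.toNat_natCast, Int.natAbs_natCast, zpow_zero, zpow_natCast, add_zero]
    generalize (Nat.factorial (m + k) : ℂ) = a at *
    generalize (Nat.factorial m : ℂ) = b at *
    rw [mul_pow, mul_pow, neg_pow, inv_pow, pow_add t]
    field_simp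
    ring
  · have h1 : min (-(k : ℤ)) 0 = -(k : ℤ) := by omega
    have h2 : (-(k : ℤ)).toNat = 0 := by omega
    have hk : (Nat.factorial (m + k) : ℂ) ≠ 0 := Nat.cast_ne_zero.2 (Nat.factorial_ne_zero _)
    simp only [h1, h2, neg_neg, Int.toNat_natCast, Int.natAbs_neg, Int.natAbs_natCast, zpow_neg,
      zpow_natCast, add_zero]
    generalize (Nat.factorial (m + k) : ℂ) = a at *
    generalize (Nat.factorial m : ℂ) = b at *
    have h3 : ((-1 : ℂ) ^ k)⁻¹ = (-1) ^ k := by rw [← inv_pow]; norm_num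
    rw [mul_pow, mul_pow, neg_pow, inv_pow, pow_add t, pow_add (-1 : ℂ), h3]
    field_simp
    ring

theorem HasSum.mul_of_summable_norm {f g : ℕ → ℂ} {a b : ℂ} (hf : HasSum f a) (hg : HasSum g b)
    (hf' : Summable fun n => ‖f n‖) (hg' : Summable fun n => ‖g n‖) :
    HasSum (fun q : ℕ × ℕ => f q.1 * g q.2) (a * b) :=
  hf.mul hg (summable_mul_of_summable_norm hf' hg')

/-- Multiply the exponential series of zt/2 and -z/(2t) and collect the terms by the power t^n; the
minimum of the two indices runs through the power series of J_{|n|}. -/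
theorem hasSum_besselInt_mul_zpow (z t : ℂ) (ht : t ≠ 0) :
    HasSum (fun n : ℤ => besselInt n z * t ^ n) (Complex.exp (z / 2 * (t - t⁻¹))) := by
  have hexp (w : ℂ) : HasSum (fun n : ℕ => w ^ n / (Nat.factorial n : ℂ)) (Complex.exp w) := by
    rw [Complex.exp_eq_exp_ℂ]
    exact NormedSpace.expSeries_div_hasSum_exp w
  have hsum (w : ℂ) : Summable fun n : ℕ => ‖w ^ n / (Nat.factorial n : ℂ)‖ :=
    NormedSpace.norm_expSeries_div_summable w
  have hp := (hexp (z / 2 * t)).mul_of_summable_norm (hexp (-(z / 2) * t⁻¹)) (hsum _) (hsum _)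
  rw [← Complex.exp_add,
    show z / 2 * t + -(z / 2) * t⁻¹ = z / 2 * (t - t⁻¹) by ring] at hp
  have hq : HasSum (fun q : ℤ × ℕ => (-1 : ℂ) ^ (min q.1 0) * t ^ q.1 *
      besselNatTerm q.1.natAbs z q.2) (Complex.exp (z / 2 * (t - t⁻¹))) := by
    rw [← diffMinEquiv.hasSum_iff] at hp
    convert hp using 1
    ext q
    exact (expTerm_mul_expTerm_diffMinEquiv z t ht q.1 q.2).symm
  refine hq.prod_fiberwise fun n => ?_
  have h := (hasSum_besselNatTerm n.natAbs z).mul_left ((-1 : ℂ) ^ (min n 0) * t ^ n)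
  rwa [mul_right_comm] at h

theorem hasSum_besselInt_exp (x s : ℝ) :
    HasSum (fun n : ℤ => besselInt n x * Complex.exp (Complex.I * n * s))
      (Complex.exp (Complex.I * (x * Real.sin s : ℝ))) := by
  have := hasSum_besselInt_mul_zpow x (Complex.exp (Complex.I * s)) (Complex.exp_ne_zero _)
  convert this using 1
  · ext n
    rw [← Complex.exp_int_mul]; congr 2; ring
  · rw [← Complex.exp_neg]
    congr 1
    push_cast
    rw [Complex.sin, show -(s:ℂ) * Complex.I = -(Complex.I * s) by ring,
      show (s:ℂ) * Complex.I = (Complex.I * s) by ring]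
    linear_combination (-x / 2 * (Complex.exp (Complex.I * s) -
      Complex.exp (-(Complex.I * s)))) * Complex.I_sq

theorem summable_norm_besselNat_bound (x : ℝ) :
    Summable fun n : ℤ => x ^ n.natAbs / (Nat.factorial n.natAbs : ℝ) * Real.exp (x ^ 2) := by
  refine Summable.mul_right _ ?_
  refine Summable.of_nat_of_neg ?_ ?_ <;> simpa using Real.summable_pow_div_factorial x

theorem summable_norm_besselInt (z : ℂ) : Summable fun n : ℤ => ‖besselInt n z‖ :=
  (summable_norm_besselNat_bound ‖z / 2‖).of_nonneg_of_le (fun _ => norm_nonneg _)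
    fun n => by rw [norm_besselInt]; exact norm_besselNat_le _ _

/-! ### Neumann's integral for products of Bessel functions -/

/-- A Chu–Vandermonde identity in terms of reciprocals of the Gamma function. -/
theorem sum_choose_mul_inv_Gamma (m : ℕ) : ∀ (n : ℕ) (a b : ℂ), a + b = n →
    ∑ q ∈ Finset.HasAntidiagonal.antidiagonal m, (m.choose q.1 : ℂ) *
      ((Complex.Gamma (q.1 + a + 1))⁻¹ * (Complex.Gamma (q.2 + b + 1))⁻¹) =
    (Nat.factorial (n + 2 * m) : ℂ) / (Nat.factorial (n + m) : ℂ) *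
      ((Complex.Gamma (m + a + 1))⁻¹ * (Complex.Gamma (m + b + 1))⁻¹) := by
  induction m with
  | zero =>
    intro n a b _
    have : (Nat.factorial n : ℂ) ≠ 0 := Nat.cast_ne_zero.2 (Nat.factorial_ne_zero _)
    simp [this]
  | succ m ih =>
    intro n a b hab
    -- Pascal's rule splits the sum into two of length m, with b or a raised by one; this is why n,
    -- a, b are generalised.
    have h1 := ih (n + 1) a (b + 1) (by push_cast; linear_combination hab)
    have h2 := ih (n + 1) (a + 1) b (by push_cast; linear_combination hab)
    rw [Finset.sum_antidiagonal_choose_succ_mul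
      (fun i j : ℕ => (Complex.Gamma (i + a + 1))⁻¹ * (Complex.Gamma (j + b + 1))⁻¹)]
    have e1 : ∀ q : ℕ × ℕ, (((q.2 + 1 : ℕ) : ℂ) + b + 1) = q.2 + (b + 1) + 1 := by
      intro q; push_cast; ring
    have e2 : ∀ q : ℕ × ℕ, (((q.1 + 1 : ℕ) : ℂ) + a + 1) = q.1 + (a + 1) + 1 := by
      intro q; push_cast; ring
    have e3 : ∀ q ∈ Finset.HasAntidiagonal.antidiagonal m, (m.choose q.2 : ℂ) = m.choose q.1 := by
      intro q hq
      rw [Nat.choose_symm_of_eq_add (Finset.HasAntidiagonal.mem_antidiagonal.1 hq).symm]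
    simp only [e1, e2]
    rw [h1, Finset.sum_congr rfl (fun q hq => by rw [e3 q hq]), h2]
    -- This form of the recurrence also holds at the poles. The two factors it yields add up to
    -- (m+a+1) + (m+b+1) = n+2m+2, the missing factor of the factorial.
    have g1 := Complex.one_div_Gamma_eq_self_mul_one_div_Gamma_add_one (m + a + 1)
    have g2 := Complex.one_div_Gamma_eq_self_mul_one_div_Gamma_add_one (m + b + 1)
    rw [show (m : ℂ) + (b + 1) + 1 = m + b + 1 + 1 by ring,
      show (m : ℂ) + (a + 1) + 1 = m + a + 1 + 1 by ring,
      show ((m + 1 : ℕ) : ℂ) + a + 1 = m + a + 1 + 1 by push_cast; ring,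
      show ((m + 1 : ℕ) : ℂ) + b + 1 = m + b + 1 + 1 by push_cast; ring, g1, g2,
      show n + 2 * (m + 1) = (n + 1 + 2 * m) + 1 by ring, show n + (m + 1) = n + 1 + m by ring,
      Nat.factorial_succ (n + 1 + 2 * m)]
    push_cast
    linear_combination (Nat.factorial (n + 1 + 2 * m) : ℂ) / (Nat.factorial (n + 1 + m) : ℂ) *
      ((Complex.Gamma (m + a + 1 + 1))⁻¹ * (Complex.Gamma (m + b + 1 + 1))⁻¹) * hab

theorem inv_Gamma_mul_inv_Gamma_one_sub (s : ℂ) :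
    (Complex.Gamma s)⁻¹ * (Complex.Gamma (1 - s))⁻¹ = Complex.sin (Real.pi * s) / Real.pi := by
  rw [← mul_inv, Complex.Gamma_mul_Gamma_one_sub, inv_div]

/-- The integral is π sin(πs)/(πs) with s = q/2, and the reflection formula writes this quotient as
1/(Γ(1+s)Γ(1-s)). -/
theorem integral_exp_half_period (q : ℤ) :
    ∫ t in -(Real.pi / 2)..(Real.pi / 2), Complex.exp (Complex.I * q * t) =
      Real.pi * ((Complex.Gamma (q / 2 + 1))⁻¹ * (Complex.Gamma (-q / 2 + 1))⁻¹) := by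
  rcases eq_or_ne q 0 with rfl | hq
  · simp
  have hq' : (q : ℂ) ≠ 0 := by exact_mod_cast hq
  rw [integral_exp_mul_complex (by simp [hq'])]
  have g := Complex.one_div_Gamma_eq_self_mul_one_div_Gamma_add_one (q / 2 : ℂ)
  have r := inv_Gamma_mul_inv_Gamma_one_sub (q / 2 : ℂ)
  rw [g] at r
  have hpi : (Real.pi : ℂ) ≠ 0 := by exact_mod_cast Real.pi_ne_zero
  rw [show (-q / 2 + 1 : ℂ) = 1 - q / 2 by ring]
  have r' : Complex.exp (Complex.I * q * ((Real.pi / 2 : ℝ) : ℂ)) -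
      Complex.exp (Complex.I * q * ((-(Real.pi / 2) : ℝ) : ℂ)) =
      2 * Complex.I * Complex.sin (Real.pi * (q / 2)) := by
    rw [Complex.sin, show Complex.I * q * ((Real.pi / 2 : ℝ) : ℂ) = Real.pi * (q / 2) * Complex.I by
      push_cast; ring, show Complex.I * q * ((-(Real.pi / 2) : ℝ) : ℂ) =
      -(Real.pi * (q / 2)) * Complex.I by push_cast; ring]
    linear_combination (Complex.exp (Real.pi * (q / 2) * Complex.I) -
      Complex.exp (-(Real.pi * (q / 2)) * Complex.I)) * Complex.I_sq
  rw [r']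
  have hs : Complex.sin (Real.pi * (q / 2)) = Real.pi * (q / 2 * (Complex.Gamma (q / 2 + 1))⁻¹ *
      (Complex.Gamma (1 - q / 2))⁻¹) := by
    rw [r]; field_simp
  rw [hs]
  have := Complex.I_ne_zero
  field_simp

/-- Cauchy's formula, by induction on p: writing one factor cos t as (e^{it} + e^{-it})/2 shifts q
by ±1, and the recurrence of 1/Γ recombines the two terms. -/
theorem integral_cos_pow_mul_exp (p : ℕ) : ∀ q : ℤ,
    ∫ t in -(Real.pi / 2)..(Real.pi / 2), (Real.cos t : ℂ) ^ p * Complex.exp (Complex.I * q * t) =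
      Real.pi * ((Nat.factorial p : ℂ) / 2 ^ p *
        ((Complex.Gamma ((p + q) / 2 + 1))⁻¹ * (Complex.Gamma ((p - q) / 2 + 1))⁻¹)) := by
  induction p with
  | zero =>
    intro q
    simpa using integral_exp_half_period q
  | succ p ih =>
    intro q
    have hstep : ∀ t : ℝ, (Real.cos t : ℂ) ^ (p + 1) * Complex.exp (Complex.I * q * t) =
        (1 / 2) * ((Real.cos t : ℂ) ^ p * Complex.exp (Complex.I * (q + 1 : ℤ) * t) +
          (Real.cos t : ℂ) ^ p * Complex.exp (Complex.I * (q - 1 : ℤ) * t)) := by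
      intro t
      have e1 : Complex.exp (Complex.I * (q + 1 : ℤ) * t) =
          Complex.exp (Complex.I * q * t) * Complex.exp (t * Complex.I) := by
        rw [← Complex.exp_add]; congr 1; push_cast; ring
      have e2 : Complex.exp (Complex.I * (q - 1 : ℤ) * t) =
          Complex.exp (Complex.I * q * t) * Complex.exp (-t * Complex.I) := by
        rw [← Complex.exp_add]; congr 1; push_cast; ring
      rw [e1, e2, pow_succ, Complex.ofReal_cos]
      conv_lhs => rw [mul_assoc]; enter [2, 1]; rw [Complex.cos]
      ring
    have hint : ∀ r : ℤ, IntervalIntegrable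
        (fun t : ℝ => (Real.cos t : ℂ) ^ p * Complex.exp (Complex.I * r * t)) volume
        (-(Real.pi / 2)) (Real.pi / 2) := fun r =>
      Continuous.intervalIntegrable (by fun_prop) _ _
    simp only [hstep]
    rw [intervalIntegral.integral_const_mul, intervalIntegral.integral_add (hint _) (hint _),
      ih, ih]
    have g1 := Complex.one_div_Gamma_eq_self_mul_one_div_Gamma_add_one ((p + q + 1) / 2 : ℂ)
    have g2 := Complex.one_div_Gamma_eq_self_mul_one_div_Gamma_add_one ((p - q + 1) / 2 : ℂ)
    push_cast
    rw [show ((p : ℂ) + (q + 1)) / 2 + 1 = (p + q + 1) / 2 + 1 by ring,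
      show ((p : ℂ) - (q + 1)) / 2 + 1 = (p - q + 1) / 2 by ring,
      show ((p : ℂ) + (q - 1)) / 2 + 1 = (p + q + 1) / 2 by ring,
      show ((p : ℂ) - (q - 1)) / 2 + 1 = (p - q + 1) / 2 + 1 by ring,
      show ((p : ℂ) + 1 + q) / 2 + 1 = (p + q + 1) / 2 + 1 by ring,
      show ((p : ℂ) + 1 - q) / 2 + 1 = (p - q + 1) / 2 + 1 by ring, g1, g2,
      Nat.factorial_succ, pow_succ]
    push_cast
    ring

theorem summable_norm_besselJ_series (ν : ℝ) (z : ℂ) : Summable fun m : ℕ =>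
    ‖(-1) ^ m / ((Nat.factorial m : ℂ) * Complex.Gamma (m + ν + 1)) * (z / 2) ^ (2 * m)‖ := by
  refine summable_of_ratio_norm_eventually_le (r := 1 / 2) (by norm_num) ?_
  -- From N on, m+ν+1 ≥ 1 keeps Γ off its poles, and m ≥ 2|z/2|² makes the ratio at most 1/2.
  obtain ⟨N, hN⟩ := exists_nat_ge (max (-ν) (2 * ‖z / 2‖ ^ 2))
  filter_upwards [Filter.eventually_ge_atTop N] with m hm
  have hm' : (N : ℝ) ≤ m := by exact_mod_cast hm
  have h1 : -ν ≤ m := (le_max_left _ _).trans (hN.trans hm')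
  have h2 : 2 * ‖z / 2‖ ^ 2 ≤ m := (le_max_right _ _).trans (hN.trans hm')
  have hpos : 1 ≤ m + ν + 1 := by linarith
  have hne : ((m : ℂ) + ν + 1) ≠ 0 := by
    intro h
    have : ((m + ν + 1 : ℝ) : ℂ) = 0 := by push_cast; exact h
    have := Complex.ofReal_eq_zero.1 this
    linarith
  have hG : Complex.Gamma ((m + 1 : ℕ) + ν + 1) = (m + ν + 1) * Complex.Gamma (m + ν + 1) := by
    rw [← Complex.Gamma_add_one _ hne]; congr 1; push_cast; ring
  have hn : ‖(m : ℂ) + ν + 1‖ = m + ν + 1 := by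
    rw [show ((m : ℂ) + ν + 1) = ((m + ν + 1 : ℝ) : ℂ) by push_cast; rfl, Complex.norm_real,
      Real.norm_of_nonneg (by linarith)]
  have hn1 : ‖((m : ℂ) + 1)‖ = m + 1 := by
    rw [show ((m : ℂ) + 1) = ((m + 1 : ℕ) : ℂ) by push_cast; rfl, Complex.norm_natCast]
    push_cast; rfl
  rw [norm_norm, norm_norm, hG, Nat.factorial_succ]
  push_cast
  have key : (-1) ^ (m + 1) / (((m : ℂ) + 1) * (Nat.factorial m : ℂ) *
      ((m + ν + 1) * Complex.Gamma (m + ν + 1))) * (z / 2) ^ (2 * (m + 1)) =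
      (-((z / 2) ^ 2 / ((m + 1) * (m + ν + 1)))) * ((-1) ^ m / ((Nat.factorial m : ℂ) *
        Complex.Gamma (m + ν + 1)) * (z / 2) ^ (2 * m)) := by
    rw [pow_succ, mul_add, pow_add]
    simp only [div_eq_mul_inv, mul_inv]
    ring
  rw [key, norm_mul]
  refine mul_le_mul_of_nonneg_right ?_ (norm_nonneg _)
  rw [norm_neg, norm_div, norm_mul, hn, hn1, norm_pow, div_le_iff₀ (by positivity)]
  nlinarith [mul_nonneg (by positivity : (0:ℝ) ≤ m + 1) (sub_nonneg.2 hpos)]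

/-- Each inner sum of the Cauchy product is a Chu–Vandermonde sum, closed in factorials because the
orders add up to a natural number. -/
theorem besselJ_series_mul (n : ℕ) (a b : ℝ) (hab : a + b = n) (z : ℂ) :
    (∑' m : ℕ, (-1) ^ m / ((Nat.factorial m : ℂ) * Complex.Gamma (m + a + 1)) *
        (z / 2) ^ (2 * m)) *
      (∑' m : ℕ, (-1) ^ m / ((Nat.factorial m : ℂ) * Complex.Gamma (m + b + 1)) *
        (z / 2) ^ (2 * m)) =
    ∑' m : ℕ, (-1) ^ m * (z / 2) ^ (2 * m) * ((Nat.factorial (n + 2 * m) : ℂ) /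
      ((Nat.factorial m : ℂ) * (Nat.factorial (n + m) : ℂ)) *
      ((Complex.Gamma (m + a + 1))⁻¹ * (Complex.Gamma (m + b + 1))⁻¹)) := by
  rw [tsum_mul_tsum_eq_tsum_sum_antidiagonal_of_summable_norm
    (summable_norm_besselJ_series a z) (summable_norm_besselJ_series b z)]
  congr 1
  ext m
  have h := sum_choose_mul_inv_Gamma m n a b (by exact_mod_cast hab)
  have hm : (Nat.factorial m : ℂ) ≠ 0 := Nat.cast_ne_zero.2 (Nat.factorial_ne_zero _)
  have hrhs : (-1) ^ m * (z / 2) ^ (2 * m) * ((Nat.factorial (n + 2 * m) : ℂ) /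
      ((Nat.factorial m : ℂ) * (Nat.factorial (n + m) : ℂ)) *
      ((Complex.Gamma (m + a + 1))⁻¹ * (Complex.Gamma (m + b + 1))⁻¹)) =
      (-1) ^ m * (z / 2) ^ (2 * m) / (Nat.factorial m : ℂ) *
      ((Nat.factorial (n + 2 * m) : ℂ) / (Nat.factorial (n + m) : ℂ) *
      ((Complex.Gamma (m + a + 1))⁻¹ * (Complex.Gamma (m + b + 1))⁻¹)) := by
    simp only [div_eq_mul_inv, mul_inv]; ring
  rw [hrhs, ← h, Finset.mul_sum]
  refine Finset.sum_congr rfl fun q hq => ?_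
  obtain ⟨i, j⟩ := q
  obtain rfl := (Finset.HasAntidiagonal.mem_antidiagonal.1 hq).symm
  dsimp only
  have hc : ((i + j).choose i : ℂ) * (Nat.factorial i : ℂ) * (Nat.factorial j : ℂ) =
      (Nat.factorial (i + j) : ℂ) := by
    rw [Nat.choose_symm_add]
    exact_mod_cast Nat.add_choose_mul_factorial_mul_factorial i j
  have hi : (Nat.factorial i : ℂ) ≠ 0 := Nat.cast_ne_zero.2 (Nat.factorial_ne_zero _)
  have hj : (Nat.factorial j : ℂ) ≠ 0 := Nat.cast_ne_zero.2 (Nat.factorial_ne_zero _)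
  have hci : ((i + j).choose i : ℂ) / (Nat.factorial (i + j) : ℂ) =
      (Nat.factorial i : ℂ)⁻¹ * (Nat.factorial j : ℂ)⁻¹ := by
    rw [← hc] at hm ⊢
    field_simp [left_ne_zero_of_mul (left_ne_zero_of_mul hm)]
  calc _ = (-1) ^ (i + j) * (z / 2) ^ (2 * (i + j)) *
        ((Nat.factorial i : ℂ)⁻¹ * (Nat.factorial j : ℂ)⁻¹) *
        ((Complex.Gamma (i + a + 1))⁻¹ * (Complex.Gamma (j + b + 1))⁻¹) := by
        rw [pow_add, mul_add, pow_add]; simp only [div_eq_mul_inv, mul_inv]; ring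
    _ = _ := by rw [← hci]; ring

/-- Neumann's integral for a product of two Bessel functions, as a Fourier coefficient. -/
theorem besselJ_mul_besselJ (n : ℕ) (k : ℤ) (z : ℝ) :
    besselJ ((n : ℝ) / 2 - k) (z / 2) * besselJ ((n : ℝ) / 2 + k) (z / 2) =
      1 / Real.pi * ∫ t in -(Real.pi / 2)..(Real.pi / 2),
        besselNat n (z * Real.cos t : ℝ) * Complex.exp (2 * Complex.I * k * t) := by
  have hpi : (Real.pi : ℂ) ≠ 0 := by exact_mod_cast Real.pi_ne_zero
  have hcos (p : ℕ) := integral_cos_pow_mul_exp p (2 * k)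
  -- At z = 0 both sides are 0 unless n = k = 0; the left side because `0 ^ s = 0` for s ≠ 0.
  rcases eq_or_ne z 0 with rfl | hz
  · simp only [zero_mul, Complex.ofReal_zero, besselNat_zero_arg]
    rcases Nat.eq_zero_or_pos n with rfl | hn
    · rcases eq_or_ne k 0 with rfl | hk
      · have := besselJ_natCast 0 0
        rw [besselNat_zero_arg] at this
        have h' : besselJ 0 0 = 1 := by simpa using this
        simp [h', hpi]
      · have hk' : (k : ℂ) ≠ 0 := by exact_mod_cast hk
        have : besselJ (((0 : ℕ) : ℝ) / 2 + k) (0 / 2) = 0 := by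
          simp [besselJ, zero_zpow k hk]
        rw [this]
        have h0 := hcos 0
        have hsin : Complex.sin (Real.pi * k) = 0 := by
          rw [mul_comm]; exact Complex.sin_int_mul_pi k
        have r := inv_Gamma_mul_inv_Gamma_one_sub (k : ℂ)
        rw [hsin, zero_div, Complex.one_div_Gamma_eq_self_mul_one_div_Gamma_add_one, mul_assoc] at r
        have r' := (mul_eq_zero.1 r).resolve_left hk'
        simp only [pow_zero, one_mul, Nat.factorial_zero, Nat.cast_one, Nat.cast_zero] at h0
        push_cast at h0
        rw [show (0 + 2 * (k : ℂ)) / 2 + 1 = k + 1 by ring,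
          show (0 - 2 * (k : ℂ)) / 2 + 1 = 1 - k by ring, r'] at h0
        have e : ∀ t : ℝ, 2 * Complex.I * k * t = Complex.I * (2 * k) * t := fun t => by ring
        simp only [if_true, one_mul, e, h0]
        simp
    · have hor : (n : ℝ) / 2 - k ≠ 0 ∨ (n : ℝ) / 2 + k ≠ 0 := by
        by_contra! h
        have : (n : ℝ) = 0 := by linarith [h.1, h.2]
        exact hn.ne' (by exact_mod_cast this)
      have h0 : besselJ ((n : ℝ) / 2 - k) (0 / 2) * besselJ ((n : ℝ) / 2 + k) (0 / 2) = 0 := by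
        rcases hor with h | h
        · have h' : (((n : ℝ) / 2 - k : ℝ) : ℂ) ≠ 0 := by exact_mod_cast h
          rw [besselJ, zero_div, zero_div, Complex.zero_cpow h']; simp
        · have h' : (((n : ℝ) / 2 + k : ℝ) : ℂ) ≠ 0 := by exact_mod_cast h
          rw [mul_comm, besselJ, zero_div, zero_div, Complex.zero_cpow h']; simp
      rw [h0]; simp [hn.ne']
  have hz4 : (z / 2 / 2 : ℂ) ≠ 0 := by
    simpa using hz
  have hint : HasSum (fun m : ℕ => ∫ t in -(Real.pi / 2)..(Real.pi / 2),
        besselNatTerm n (z * Real.cos t : ℝ) m * Complex.exp (2 * Complex.I * k * t))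
      (∫ t in -(Real.pi / 2)..(Real.pi / 2),
        besselNat n (z * Real.cos t : ℝ) * Complex.exp (2 * Complex.I * k * t)) := by
    have hexp : ∀ t : ℝ, ‖Complex.exp (2 * Complex.I * k * t)‖ = 1 := by
      intro t
      rw [show 2 * Complex.I * k * t = ((2 * k * t : ℝ) : ℂ) * Complex.I by push_cast; ring,
        Complex.norm_exp_ofReal_mul_I]
    refine intervalIntegral.hasSum_integral_of_dominated_convergence
      (fun m _ => |z / 2| ^ n / (Nat.factorial n : ℝ) *
      ((|z / 2| ^ 2) ^ m / (Nat.factorial m : ℝ))) (fun m => ?_) (fun m => ?_) ?_ ?_ ?_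
    · refine Continuous.aestronglyMeasurable ?_
      unfold besselNatTerm
      fun_prop
    · refine Filter.Eventually.of_forall fun t _ => ?_
      rw [norm_mul, hexp, mul_one]
      refine (norm_besselNatTerm_le _ _ _).trans ?_
      have : ‖((z * Real.cos t : ℝ) : ℂ) / 2‖ ≤ |z / 2| := by
        rw [norm_div, Complex.norm_real, Complex.norm_ofNat, Real.norm_eq_abs, abs_mul, abs_div,
          abs_two]
        have := mul_le_of_le_one_right (abs_nonneg z) (Real.abs_cos_le_one t)
        gcongr
      gcongr
    · exact Filter.Eventually.of_forall fun t _ => summable_besselNatTerm_bound n _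
    · exact intervalIntegrable_const
    · exact Filter.Eventually.of_forall fun t _ => (hasSum_besselNatTerm n _).mul_right _
  -- The two complex powers combine into the n-th power of z/4, so the choice of branch has no
  -- effect, even for negative z. Both sides are then power series, compared term by term.
  rw [← hint.tsum_eq, besselJ, besselJ, mul_mul_mul_comm, besselJ_series_mul n _ _ (by ring),
    ← Complex.cpow_add _ _ hz4, ← tsum_mul_left, ← tsum_mul_left]
  have hexp : (((n : ℝ) / 2 - k : ℝ) : ℂ) + (((n : ℝ) / 2 + k : ℝ) : ℂ) = n := by
    push_cast; ring
  rw [hexp, Complex.cpow_natCast]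
  congr 1
  ext m
  have e : ∀ t : ℝ, besselNatTerm n (z * Real.cos t : ℝ) m * Complex.exp (2 * Complex.I * k * t) =
      (-1) ^ m / ((Nat.factorial m : ℂ) * (Nat.factorial (m + n) : ℂ)) * (z / 2) ^ (2 * m + n) *
      ((Real.cos t : ℂ) ^ (2 * m + n) * Complex.exp (Complex.I * (2 * k : ℤ) * t)) := by
    intro t
    rw [show Complex.I * (2 * k : ℤ) * t = 2 * Complex.I * k * t by push_cast; ring,
      besselNatTerm, Complex.ofReal_mul, mul_div_right_comm, mul_pow]
    ring
  simp only [e]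
  rw [intervalIntegral.integral_const_mul, hcos]
  push_cast
  rw [show (2 * (m : ℂ) + n + 2 * k) / 2 + 1 = m + (n / 2 + k) + 1 by ring,
    show (2 * (m : ℂ) + n - 2 * k) / 2 + 1 = m + (n / 2 - k) + 1 by ring,
    show n + 2 * m = 2 * m + n by ring, show n + m = m + n by ring]
  rw [show ((z : ℂ) / 2) = 2 * (z / 2 / 2) by ring, mul_pow, pow_add (z / 2 / 2 : ℂ)]
  rw [show (2 * ((z : ℂ) / 2 / 2)) / 2 = z / 2 / 2 by ring]
  field_simp

/-! ### Bounded convergence of the sawtooth series -/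

theorem sin_half_mul_dirichletKernel (N : ℕ) (x : ℝ) :
    Real.sin (x / 2) * (1 / 2 + ∑ k ∈ Finset.range N, Real.cos ((k + 1 : ℕ) * x)) =
      Real.sin ((N + 1 / 2) * x) / 2 := by
  induction N with
  | zero => simp; ring_nf
  | succ N ih =>
    rw [Finset.sum_range_succ, ← add_assoc, mul_add, ih]
    have h1 : ((N : ℝ) + 1 / 2) * x = ((N + 1 : ℕ) : ℝ) * x - x / 2 := by push_cast; ring
    have h2 : (((N + 1 : ℕ) : ℝ) + 1 / 2) * x = ((N + 1 : ℕ) : ℝ) * x + x / 2 := by push_cast; ring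
    rw [h1, h2, Real.sin_sub, Real.sin_add]
    ring

/-- The partial sums of the sawtooth series `∑ sin (k x) / k`. -/
noncomputable def sawSum (N : ℕ) (x : ℝ) : ℝ :=
  ∑ k ∈ Finset.range N, Real.sin ((k + 1 : ℕ) * x) / (k + 1 : ℕ)

theorem hasDerivAt_sawSum (N : ℕ) (x : ℝ) :
    HasDerivAt (sawSum N) (∑ k ∈ Finset.range N, Real.cos ((k + 1 : ℕ) * x)) x := by
  unfold sawSum
  refine HasDerivAt.fun_sum fun k _ => ?_
  have h : ((k + 1 : ℕ) : ℝ) ≠ 0 := by positivity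
  have := (((hasDerivAt_id' x).const_mul ((k + 1 : ℕ) : ℝ)).sin).div_const ((k + 1 : ℕ) : ℝ)
  refine this.congr_deriv ?_
  field_simp

/-- The partial sums of the sawtooth series approximate the sawtooth away from its jump. -/
theorem abs_sawSum_sub_le (N : ℕ) {x : ℝ} (hx0 : 0 < x) (hxpi : x ≤ Real.pi) :
    |sawSum N x - (Real.pi - x) / 2| ≤ 1 / ((N + 1 / 2) * Real.sin (x / 2)) := by
  set r : ℝ := N + 1 / 2 with hr
  have hrpos : 0 < r := by positivity
  have hspos : ∀ y ∈ Set.Icc x Real.pi, 0 < Real.sin (y / 2) := fun y hy =>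
    Real.sin_pos_of_pos_of_lt_pi (by linarith [hy.1]) (by linarith [hy.2, Real.pi_pos])
  -- The error has derivative sin(ry)/(2 sin(y/2)), by the Dirichlet kernel. Adding cos(ry) B(y), as
  -- in an integration by parts, leaves the derivative cos(ry) B'(y), of modulus at most -B'(y). So
  -- E + B decreases, E - B increases, and E(π) = 0 bounds E by B.
  set B : ℝ → ℝ := fun y => 1 / (2 * r) * (Real.sin (y / 2))⁻¹ with hB
  set B' : ℝ → ℝ := fun y => -(1 / (2 * r) * (Real.cos (y / 2) / 2 / Real.sin (y / 2) ^ 2)) with hB'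
  have hdB : ∀ y ∈ Set.Icc x Real.pi, HasDerivAt B (B' y) y := by
    intro y hy
    have h := (((hasDerivAt_id' y).div_const 2).sin.fun_inv (hspos y hy).ne').const_mul (1 / (2 * r))
    refine h.congr_deriv ?_
    simp only [hB']
    ring
  have hB'nonpos : ∀ y ∈ Set.Icc x Real.pi, B' y ≤ 0 := by
    intro y hy
    have := Real.cos_nonneg_of_neg_pi_div_two_le_of_le (x := y / 2)
      (by linarith [hy.1, Real.pi_pos]) (by linarith [hy.2])
    simp only [hB', Left.neg_nonpos_iff]
    positivity
  set E : ℝ → ℝ := fun y => sawSum N y - (Real.pi - y) / 2 + Real.cos (r * y) * B y with hE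
  have hdE : ∀ y ∈ Set.Icc x Real.pi, HasDerivAt E (Real.cos (r * y) * B' y) y := by
    intro y hy
    have h1 := (hasDerivAt_sawSum N y).sub (((hasDerivAt_id' y).const_sub Real.pi).div_const 2)
    have h2 := (((hasDerivAt_id' y).const_mul r).cos).mul (hdB y hy)
    have h := h1.add h2
    refine h.congr_deriv ?_
    have hk := sin_half_mul_dirichletKernel N y
    rw [← hr] at hk
    have hs := (hspos y hy).ne'
    simp only [hB]
    rw [mul_comm, ← eq_div_iff hs] at hk
    have : Real.sin (r * y) = 2 * Real.sin (y / 2) *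
        (1 / 2 + ∑ k ∈ Finset.range N, Real.cos ((k + 1 : ℕ) * y)) := by
      rw [hk]; field_simp
    rw [this]
    generalize ∑ k ∈ Finset.range N, Real.cos ((k + 1 : ℕ) * y) = c
    field_simp
    ring
  have hE1 : AntitoneOn (fun y => E y + B y) (Set.Icc x Real.pi) := by
    refine antitoneOn_of_hasDerivWithinAt_nonpos (f' := fun y => Real.cos (r * y) * B' y + B' y)
      (convex_Icc _ _)
      (fun y hy => ((hdE y hy).add (hdB y hy)).continuousAt.continuousWithinAt)
      (fun y hy => ((hdE y (interior_subset hy)).add (hdB y (interior_subset hy))).hasDerivWithinAt)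
      (fun y hy => ?_)
    have := hB'nonpos y (interior_subset hy)
    nlinarith [Real.neg_one_le_cos (r * y)]
  have hE2 : MonotoneOn (fun y => E y - B y) (Set.Icc x Real.pi) := by
    refine monotoneOn_of_hasDerivWithinAt_nonneg (f' := fun y => Real.cos (r * y) * B' y - B' y)
      (convex_Icc _ _)
      (fun y hy => ((hdE y hy).sub (hdB y hy)).continuousAt.continuousWithinAt)
      (fun y hy => ((hdE y (interior_subset hy)).sub (hdB y (interior_subset hy))).hasDerivWithinAt)
      (fun y hy => ?_)
    have := hB'nonpos y (interior_subset hy)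
    nlinarith [Real.cos_le_one (r * y)]
  have hmx : x ∈ Set.Icc x Real.pi := ⟨le_rfl, hxpi⟩
  have hmp : Real.pi ∈ Set.Icc x Real.pi := ⟨hxpi, le_rfl⟩
  have hEpi : E Real.pi = 0 := by
    have h1 : sawSum N Real.pi = 0 := by
      refine Finset.sum_eq_zero fun k _ => ?_
      rw [Real.sin_nat_mul_pi, zero_div]
    have h2 : Real.cos (r * Real.pi) = 0 := by
      rw [hr, add_mul, Real.cos_add, Real.sin_nat_mul_pi,
        show 1 / 2 * Real.pi = Real.pi / 2 by ring, Real.cos_pi_div_two]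
      ring
    simp only [hE, h1, h2]
    ring
  have hBpos : ∀ y ∈ Set.Icc x Real.pi, 0 < B y := fun y hy => by
    have := hspos y hy
    simp only [hB]; positivity
  have k1 := hE1 hmx hmp hxpi
  have k2 := hE2 hmx hmp hxpi
  simp only [hEpi] at k1 k2
  have hb := hBpos _ hmp
  have hEx : sawSum N x - (Real.pi - x) / 2 = E x - Real.cos (r * x) * B x := by
    simp only [hE]; ring
  have h2B : 1 / (r * Real.sin (x / 2)) = 2 * B x := by
    simp only [hB]
    have := (hspos x hmx).ne'
    field_simp
  have hbx := hBpos x hmx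
  rw [hEx, h2B, abs_le]
  constructor <;> nlinarith [Real.cos_le_one (r * x), Real.neg_one_le_cos (r * x)]

theorem abs_sawSum_le_mul (N : ℕ) {x : ℝ} (hx : 0 ≤ x) : |sawSum N x| ≤ N * x := by
  refine (Finset.abs_sum_le_sum_abs _ _).trans ?_
  have : ∀ k ∈ Finset.range N, |Real.sin ((k + 1 : ℕ) * x) / (k + 1 : ℕ)| ≤ x := by
    intro k _
    have hk : (0 : ℝ) < (k + 1 : ℕ) := by positivity
    rw [abs_div, abs_of_pos hk, div_le_iff₀ hk]
    refine Real.abs_sin_le_abs.trans ?_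
    rw [abs_mul, abs_of_pos hk, abs_of_nonneg hx, mul_comm]
  refine (Finset.sum_le_sum this).trans ?_
  simp

/-- The bound is uniform in N and x: near the jump, where Nx ≤ 1, the trivial bound Nx suffices;
elsewhere Jordan's inequality sin(x/2) ≥ x/π keeps the error estimate below π. -/
theorem abs_sawSum_le (N : ℕ) {x : ℝ} (hx0 : 0 < x) (hxpi : x ≤ Real.pi) :
    |sawSum N x| ≤ 2 * Real.pi := by
  have hpi := Real.pi_gt_three
  rcases le_or_gt ((N : ℝ) * x) 1 with h | h
  · exact (abs_sawSum_le_mul N hx0.le).trans (by linarith)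
  · have h1 := abs_sawSum_sub_le N hx0 hxpi
    have hs : x / Real.pi ≤ Real.sin (x / 2) := by
      have := Real.mul_le_sin (x := x / 2) (by linarith) (by linarith)
      calc x / Real.pi = 2 / Real.pi * (x / 2) := by ring
        _ ≤ _ := this
    have h2 : 1 / ((N + 1 / 2) * Real.sin (x / 2)) ≤ Real.pi := by
      have hsp : 0 < x / Real.pi := by positivity
      have hsp' := hsp.trans_le hs
      rw [div_le_iff₀ (by positivity)]
      have : (N : ℝ) * x ≤ (N + 1 / 2) * (Real.sin (x / 2) * Real.pi) := by
        have : x ≤ Real.sin (x / 2) * Real.pi := by rwa [div_le_iff₀ Real.pi_pos] at hs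
        gcongr
        linarith
      linarith
    have h3 := abs_le.1 (h1.trans h2)
    rw [abs_le]
    constructor <;> linarith [h3.1, h3.2]

theorem tendsto_sawSum {x : ℝ} (hx0 : 0 < x) (hxpi : x ≤ Real.pi) :
    Filter.Tendsto (fun N => sawSum N x) Filter.atTop (nhds ((Real.pi - x) / 2)) := by
  rw [tendsto_iff_norm_sub_tendsto_zero]
  have hs : 0 < Real.sin (x / 2) :=
    Real.sin_pos_of_pos_of_lt_pi (by linarith) (by linarith [Real.pi_pos])
  refine squeeze_zero (fun _ => norm_nonneg _) (fun N => abs_sawSum_sub_le N hx0 hxpi) ?_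
  refine Filter.Tendsto.div_atTop tendsto_const_nhds ?_
  exact (Filter.tendsto_atTop_add_const_right _ _ tendsto_natCast_atTop_atTop).atTop_mul_const hs

theorem sawSum_two_pi_sub (N : ℕ) (x : ℝ) : sawSum N (2 * Real.pi - x) = -sawSum N x := by
  unfold sawSum
  rw [← Finset.sum_neg_distrib]
  refine Finset.sum_congr rfl fun k _ => ?_
  rw [mul_sub, mul_left_comm, ← mul_assoc, mul_comm 2, mul_assoc, Real.sin_nat_mul_two_pi_sub]
  ring

/-- The partial sums of the Fourier series of `w ↦ w` on `(-π/2, π/2)` are bounded. -/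
theorem abs_sawSum_pi_sub_le (N : ℕ) {w : ℝ} (hw : w ∈ Set.Ioo (-(Real.pi / 2)) (Real.pi / 2)) :
    |sawSum N (Real.pi - 2 * w)| ≤ 2 * Real.pi := by
  rcases le_total 0 w with h | h
  · exact abs_sawSum_le N (by linarith [hw.2]) (by linarith)
  · rw [show Real.pi - 2 * w = 2 * Real.pi - (Real.pi + 2 * w) by ring, sawSum_two_pi_sub, abs_neg]
    exact abs_sawSum_le N (by linarith [hw.1]) (by linarith)

theorem tendsto_sawSum_pi_sub {w : ℝ} (hw : w ∈ Set.Ioo (-(Real.pi / 2)) (Real.pi / 2)) :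
    Filter.Tendsto (fun N => sawSum N (Real.pi - 2 * w)) Filter.atTop (nhds w) := by
  rcases le_total 0 w with h | h
  · convert tendsto_sawSum (x := Real.pi - 2 * w) (by linarith [hw.2]) (by linarith) using 2
    ring
  · have h1 := (tendsto_sawSum (x := Real.pi + 2 * w) (by linarith [hw.1]) (by linarith)).neg
    convert h1 using 2
    · rw [← sawSum_two_pi_sub]; congr 1; ring
    · ring

/-! ### Fourier series on [-π/2, π/2] -/

/-- The Fourier monomial `e^{2ikt}` of period `π`. -/
noncomputable def piExp (k : ℤ) (t : ℝ) : ℂ := Complex.exp (2 * Complex.I * k * t)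

theorem norm_piExp (k : ℤ) (t : ℝ) : ‖piExp k t‖ = 1 := by
  rw [piExp, show 2 * Complex.I * k * t = ((2 * k * t : ℝ) : ℂ) * Complex.I by push_cast; ring,
    Complex.norm_exp_ofReal_mul_I]

theorem continuous_piExp (k : ℤ) : Continuous (piExp k) := by
  unfold piExp; fun_prop

theorem piExp_add (k m : ℤ) (t : ℝ) : piExp (k + m) t = piExp k t * piExp m t := by
  rw [piExp, piExp, piExp, ← Complex.exp_add]; congr 1; push_cast; ring

theorem piExp_zero (t : ℝ) : piExp 0 t = 1 := by simp [piExp]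

theorem piExp_pi_div_two (k : ℤ) : piExp k (Real.pi / 2) = (-1) ^ k := by
  rw [piExp, ← Complex.exp_pi_mul_I, ← Complex.exp_int_mul]; congr 1; push_cast; ring

theorem piExp_neg_pi_div_two (k : ℤ) : piExp k (-(Real.pi / 2)) = (-1) ^ k := by
  have : piExp k (-(Real.pi / 2)) = piExp (-k) (Real.pi / 2) := by
    rw [piExp, piExp]; congr 1; push_cast; ring
  rw [this, piExp_pi_div_two, zpow_neg, ← inv_zpow]; norm_num

theorem hasDerivAt_piExp (k : ℤ) (t : ℝ) :
    HasDerivAt (piExp k) (2 * Complex.I * k * piExp k t) t := by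
  have h := ((Complex.ofRealCLM.hasDerivAt (x := t)).const_mul (2 * Complex.I * k)).cexp
  refine h.congr_deriv ?_
  simp [piExp]; ring

/-- Fourier coefficients on the interval `[-π/2, π/2]`. -/
noncomputable def fcoef (F : ℝ → ℂ) (k : ℤ) : ℂ :=
  1 / Real.pi * ∫ t in -(Real.pi / 2)..(Real.pi / 2), F t * piExp (-k) t

theorem fcoef_add {F G : ℝ → ℂ} (hF : Continuous F) (hG : Continuous G) (k : ℤ) :
    fcoef (fun t => F t + G t) k = fcoef F k + fcoef G k := by
  have := continuous_piExp (-k)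
  simp only [fcoef, add_mul]
  rw [intervalIntegral.integral_add (Continuous.intervalIntegrable (by fun_prop) _ _)
    (Continuous.intervalIntegrable (by fun_prop) _ _)]
  ring

theorem fcoef_const_mul (c : ℂ) (F : ℝ → ℂ) (k : ℤ) :
    fcoef (fun t => c * F t) k = c * fcoef F k := by
  simp only [fcoef, mul_assoc]
  rw [intervalIntegral.integral_const_mul]
  ring

theorem exists_norm_fcoef_le {F : ℝ → ℂ} (hF : Continuous F) : ∃ C, ∀ k, ‖fcoef F k‖ ≤ C := by
  obtain ⟨C, hC⟩ := isCompact_uIcc.exists_bound_of_continuousOn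
    (s := Set.uIcc (-(Real.pi / 2)) (Real.pi / 2)) hF.continuousOn
  refine ⟨‖(1 / Real.pi : ℂ)‖ * (C * |Real.pi / 2 - -(Real.pi / 2)|), fun k => ?_⟩
  rw [fcoef, norm_mul]
  refine mul_le_mul_of_nonneg_left ?_ (norm_nonneg _)
  refine intervalIntegral.norm_integral_le_of_norm_le_const fun t ht => ?_
  rw [norm_mul, norm_piExp, mul_one]
  exact hC t (Set.uIoc_subset_uIcc ht)

/-- Integration by parts for Fourier coefficients. -/
theorem fcoef_eq_of_hasDerivAt {F F' : ℝ → ℂ} (hF : ∀ t, HasDerivAt F (F' t) t)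
    (hF' : Continuous F') {k : ℤ} (hk : k ≠ 0) :
    fcoef F k = (fcoef F' k - (-1) ^ k * (F (Real.pi / 2) - F (-(Real.pi / 2))) / Real.pi) /
      (2 * Complex.I * k) := by
  have hk' : (k : ℂ) ≠ 0 := by exact_mod_cast hk
  have hI := Complex.I_ne_zero
  have h := intervalIntegral.integral_mul_deriv_eq_deriv_mul
    (a := -(Real.pi / 2)) (b := Real.pi / 2) (u := F) (u' := F') (v := piExp (-k))
    (v' := fun t => 2 * Complex.I * (-k : ℤ) * piExp (-k) t) (fun t _ => hF t)
    (fun t _ => hasDerivAt_piExp (-k) t) (hF'.intervalIntegrable _ _)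
    ((continuous_const.mul (continuous_piExp _)).intervalIntegrable _ _)
  rw [piExp_pi_div_two, piExp_neg_pi_div_two] at h
  have e : ∀ t, F t * (2 * Complex.I * (-k : ℤ) * piExp (-k) t) =
      (2 * Complex.I * (-k : ℤ)) * (F t * piExp (-k) t) := fun t => by ring
  simp only [e] at h
  rw [intervalIntegral.integral_const_mul] at h
  have hs : (-1 : ℂ) ^ (-k) = (-1) ^ k := by rw [zpow_neg, ← inv_zpow]; norm_num
  rw [hs] at h
  have hpi : (Real.pi : ℂ) ≠ 0 := by exact_mod_cast Real.pi_ne_zero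
  rw [fcoef, fcoef, eq_div_iff (by simp [hk'])]
  push_cast at h
  linear_combination (-1 / Real.pi : ℂ) * h

theorem fcoef_one {k : ℤ} (hk : k ≠ 0) : fcoef (fun _ => 1) k = 0 := by
  rw [fcoef_eq_of_hasDerivAt (fun t => hasDerivAt_const t (1 : ℂ)) continuous_const hk]
  simp [fcoef]

theorem fcoef_ofReal {k : ℤ} (hk : k ≠ 0) :
    fcoef (fun t => (t : ℂ)) k = -(-1) ^ k / (2 * Complex.I * k) := by
  have hpi : (Real.pi : ℂ) ≠ 0 := by exact_mod_cast Real.pi_ne_zero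
  have hd : ∀ t : ℝ, HasDerivAt (fun t : ℝ => (t : ℂ)) 1 t := fun t =>
    (hasDerivAt_id (t : ℂ)).comp_ofReal
  rw [fcoef_eq_of_hasDerivAt hd continuous_const hk, fcoef_one hk]
  push_cast
  field_simp
  ring

theorem fcoef_ofReal_zero : fcoef (fun t => (t : ℂ)) 0 = 0 := by
  simp only [fcoef, neg_zero, piExp_zero, mul_one]
  rw [intervalIntegral.integral_ofReal, integral_id]
  simp

theorem Finset.sum_Icc_neg_natCast (f : ℤ → ℂ) (N : ℕ) :
    ∑ k ∈ Finset.Icc (-(N : ℤ)) N, f k =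
      f 0 + ∑ k ∈ Finset.range N, (f (k + 1 : ℕ) + f (-(k + 1 : ℕ))) := by
  induction N with
  | zero => simp
  | succ N ih =>
    rw [Nat.cast_add, Nat.cast_one, Finset.Icc_succ_succ, Finset.sum_union (by simp),
      Finset.sum_pair (by lia), ih, Finset.sum_range_succ]
    push_cast
    ring

theorem sum_fcoef_ofReal (N : ℕ) (w : ℝ) :
    ∑ k ∈ Finset.Icc (-(N : ℤ)) N, fcoef (fun t => (t : ℂ)) k * piExp k w =
      (sawSum N (Real.pi - 2 * w) : ℂ) := by
  rw [Finset.sum_Icc_neg_natCast, fcoef_ofReal_zero, zero_mul, zero_add, sawSum,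
    Complex.ofReal_sum]
  refine Finset.sum_congr rfl fun k _ => ?_
  have hk : ((k + 1 : ℕ) : ℤ) ≠ 0 := by positivity
  rw [fcoef_ofReal hk, fcoef_ofReal (neg_ne_zero.2 hk)]
  generalize k + 1 = m at *
  have hm : (m : ℂ) ≠ 0 := by exact_mod_cast hk
  have hs : (-1 : ℂ) ^ (-(m : ℤ)) = (-1) ^ m := by
    rw [zpow_neg, ← inv_zpow]; norm_num
  rw [hs, mul_sub, Real.sin_nat_mul_pi_sub]
  push_cast
  rw [Complex.sin, piExp, piExp]
  push_cast
  rw [show 2 * Complex.I * -(m : ℂ) * w = -(m * (2 * w)) * Complex.I by ring,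
    show 2 * Complex.I * (m : ℂ) * w = (m * (2 * w)) * Complex.I by ring]
  have hI := Complex.I_ne_zero
  rw [zpow_natCast]
  field_simp
  rw [Complex.I_sq]
  ring

/-- Two integrations by parts give O(k⁻²). Equal end values remove the boundary term of the first; a
jump of the derivative only enters the constant D. -/
theorem summable_norm_fcoef {F : ℝ → ℂ} (hF : ContDiff ℝ 2 F)
    (hper : F (Real.pi / 2) = F (-(Real.pi / 2))) : Summable fun k => ‖fcoef F k‖ := by
  have hF1 : ContDiff ℝ 1 (deriv F) := (contDiff_succ_iff_deriv.1 hF).2.2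
  have hF0 : Continuous (deriv (deriv F)) := (contDiff_one_iff_deriv.1 hF1).2
  have hd : ∀ t, HasDerivAt F (deriv F t) t := fun t =>
    (hF.differentiable (by norm_num) t).hasDerivAt
  have hd1 : ∀ t, HasDerivAt (deriv F) (deriv (deriv F) t) t := fun t =>
    (hF1.differentiable (by norm_num) t).hasDerivAt
  obtain ⟨C, hC⟩ := exists_norm_fcoef_le hF0
  set D : ℝ := C + ‖(deriv F (Real.pi / 2) - deriv F (-(Real.pi / 2))) / (Real.pi : ℂ)‖ with hD
  have hs : Summable fun k : ℤ => D / 4 * (1 / (k : ℝ) ^ 2) :=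
    (Real.summable_one_div_int_pow.2 one_lt_two).mul_left _
  refine hs.of_norm_bounded_eventually ?_
  have hfin : ∀ᶠ k : ℤ in Filter.cofinite, k ≠ 0 :=
    (Set.finite_singleton (0 : ℤ)).compl_mem_cofinite
  filter_upwards [hfin] with k hk
  rw [norm_norm, fcoef_eq_of_hasDerivAt hd hF1.continuous hk,
    fcoef_eq_of_hasDerivAt hd1 hF0 hk, hper, sub_self, mul_zero, zero_div, sub_zero, norm_div,
    norm_div]
  have hkpos : 0 < |(k : ℝ)| := by positivity
  have hn : ‖2 * Complex.I * (k : ℂ)‖ = 2 * |(k : ℝ)| := by simp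
  have hb : ‖fcoef (deriv (deriv F)) k - (-1) ^ k *
      (deriv F (Real.pi / 2) - deriv F (-(Real.pi / 2))) / Real.pi‖ ≤ D := by
    refine (norm_sub_le _ _).trans (add_le_add (hC k) ?_)
    rw [mul_div_assoc, norm_mul]
    simp
  rw [hn, div_div, div_le_iff₀ (by positivity)]
  refine hb.trans (le_of_eq ?_)
  have : (k : ℝ) ≠ 0 := abs_pos.1 hkpos
  rw [← sq_abs (k : ℝ)]
  field_simp
  ring

/-- Gluing the end points gives a continuous function on a circle of length π, whose Fourier series
converges pointwise because its coefficients are summable. -/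
theorem hasSum_fcoef_mul_piExp {F : ℝ → ℂ} (hF : ContDiff ℝ 2 F)
    (hper : F (Real.pi / 2) = F (-(Real.pi / 2))) {w : ℝ}
    (hw : w ∈ Set.Icc (-(Real.pi / 2)) (Real.pi / 2)) :
    HasSum (fun k => fcoef F k * piExp k w) (F w) := by
  have : Fact (0 < Real.pi) := ⟨Real.pi_pos⟩
  have hend : -(Real.pi / 2) + Real.pi = Real.pi / 2 := by ring
  have hper' : F (-(Real.pi / 2)) = F (-(Real.pi / 2) + Real.pi) := by rw [hend, hper]
  set f : C(AddCircle Real.pi, ℂ) :=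
    ⟨AddCircle.liftIco Real.pi (-(Real.pi / 2)) F,
      AddCircle.liftIco_continuous hper' hF.continuous.continuousOn⟩ with hf
  have hfour : ∀ (k : ℤ) (t : ℝ), fourier k (t : AddCircle Real.pi) = piExp k t := by
    intro k t
    have hpi : (Real.pi : ℂ) ≠ 0 := by exact_mod_cast Real.pi_ne_zero
    rw [fourier_coe_apply, piExp]
    congr 1
    field_simp
  have hcoef : fourierCoeff f = fcoef F := by
    ext k
    have : fourierCoeff f k = fourierCoeff (AddCircle.liftIco Real.pi (-(Real.pi / 2)) F) k := rfl
    rw [this, fourierCoeff_liftIco_eq, fourierCoeffOn_eq_integral, fcoef]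
    rw [Complex.real_smul, add_sub_cancel_left, hend]
    push_cast
    refine congrArg _ (intervalIntegral.integral_congr fun t _ => ?_)
    simp only [smul_eq_mul]
    rw [mul_comm, ← hfour]
  have key : ∀ w ∈ Set.Ico (-(Real.pi / 2)) (Real.pi / 2),
      HasSum (fun k => fcoef F k * piExp k w) (F w) := by
    intro w hw
    have h := has_pointwise_sum_fourier_series_of_summable (f := f)
      (by rw [hcoef]; exact (summable_norm_fcoef hF hper).of_norm) (w : AddCircle Real.pi)
    have hval : f (w : AddCircle Real.pi) = F w := by
      rw [hf]
      exact AddCircle.liftIco_coe_apply (by rwa [hend])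
    rw [hval, hcoef] at h
    simpa only [smul_eq_mul, hfour] using h
  rcases eq_or_lt_of_le hw.2 with h | h
  · rw [h, hper]
    have := key (-(Real.pi / 2)) ⟨le_rfl, by linarith [Real.pi_pos]⟩
    simpa only [piExp_pi_div_two, piExp_neg_pi_div_two] using this
  · exact key w ⟨hw.1, h⟩

/-- The symmetric partial sums of the Fourier series of a `C²` function on `[-π/2, π/2]`
converge boundedly to the function on the open interval. -/
theorem fourier_bounded_convergence {F : ℝ → ℂ} (hF : ContDiff ℝ 2 F) :
    ∃ C : ℝ, ∀ w ∈ Set.Ioo (-(Real.pi / 2)) (Real.pi / 2),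
      (∀ N : ℕ, ‖∑ k ∈ Finset.Icc (-(N : ℤ)) N, fcoef F k * piExp k w‖ ≤ C) ∧
      Filter.Tendsto (fun N : ℕ => ∑ k ∈ Finset.Icc (-(N : ℤ)) N, fcoef F k * piExp k w)
        Filter.atTop (nhds (F w)) := by
  have hpi : (Real.pi : ℂ) ≠ 0 := by exact_mod_cast Real.pi_ne_zero
  -- The slope for which F(t) - αt has equal end values; this remainder has summable coefficients,
  -- and αt contributes sawtooth sums.
  set α : ℂ := (F (Real.pi / 2) - F (-(Real.pi / 2))) / Real.pi with hα
  set H : ℝ → ℂ := fun t => F t + -α * t with hH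
  have hHc : ContDiff ℝ 2 H := by
    refine hF.add (contDiff_const.mul Complex.ofRealCLM.contDiff)
  have hHper : H (Real.pi / 2) = H (-(Real.pi / 2)) := by
    simp only [hH, hα]; push_cast; field_simp; ring
  have hsplit : ∀ k, fcoef F k = fcoef H k + α * fcoef (fun t => (t : ℂ)) k := by
    intro k
    rw [hH, fcoef_add hF.continuous (by fun_prop), fcoef_const_mul]
    ring
  have hsum : ∀ (N : ℕ) (w : ℝ), ∑ k ∈ Finset.Icc (-(N : ℤ)) N, fcoef F k * piExp k w =
      ∑ k ∈ Finset.Icc (-(N : ℤ)) N, fcoef H k * piExp k w +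
        α * (sawSum N (Real.pi - 2 * w) : ℂ) := by
    intro N w
    rw [← sum_fcoef_ofReal, Finset.mul_sum, ← Finset.sum_add_distrib]
    refine Finset.sum_congr rfl fun k _ => ?_
    rw [hsplit]; ring
  have hHs := summable_norm_fcoef hHc hHper
  refine ⟨∑' k, ‖fcoef H k‖ + ‖α‖ * (2 * Real.pi), fun w hw => ⟨fun N => ?_, ?_⟩⟩
  · rw [hsum]
    refine (norm_add_le _ _).trans (add_le_add ?_ ?_)
    · refine (norm_sum_le _ _).trans ?_
      simp only [norm_mul, norm_piExp, mul_one]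
      exact hHs.sum_le_tsum _ fun k _ => norm_nonneg _
    · rw [norm_mul, Complex.norm_real]
      exact mul_le_mul_of_nonneg_left (abs_sawSum_pi_sub_le N hw) (norm_nonneg _)
  · simp only [hsum]
    have h1 : Filter.Tendsto (fun N : ℕ => ∑ k ∈ Finset.Icc (-(N : ℤ)) N, fcoef H k * piExp k w)
        Filter.atTop (nhds (H w)) :=
      hasSum_symmetricIcc_iff.1 ((hasSum_fcoef_mul_piExp hHc hHper
        (Set.Ioo_subset_Icc_self hw)).mono_left (symmetricIcc ℤ).le_atTop)
    have h2 := ((Complex.continuous_ofReal.tendsto w).comp (tendsto_sawSum_pi_sub hw)).const_mul α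
    have hlim : F w = H w + α * w := by simp only [hH]; ring
    rw [hlim]
    exact h1.add h2

/-- The Fourier coefficients of a product are a convolution. -/
theorem hasSum_fcoef_mul {F G : ℝ → ℂ} (hF : ContDiff ℝ 2 F)
    (hper : F (Real.pi / 2) = F (-(Real.pi / 2))) (hG : Continuous G) (k : ℤ) :
    HasSum (fun m => fcoef F m * fcoef G (k - m)) (fcoef (fun t => F t * G t) k) := by
  -- Only F is expanded and integrated termwise; G may jump between the end points.
  have h : HasSum (fun m => ∫ t in -(Real.pi / 2)..(Real.pi / 2),
      fcoef F m * piExp m t * (G t * piExp (-k) t))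
      (∫ t in -(Real.pi / 2)..(Real.pi / 2), F t * (G t * piExp (-k) t)) := by
    refine intervalIntegral.hasSum_integral_of_dominated_convergence
      (fun m t => ‖fcoef F m‖ * ‖G t‖) (fun m => ?_) (fun m => ?_) ?_ ?_ ?_
    · have h1 := continuous_piExp m
      have h2 := continuous_piExp (-k)
      exact Continuous.aestronglyMeasurable (by fun_prop)
    · refine Filter.Eventually.of_forall fun t _ => le_of_eq ?_
      simp only [norm_mul, norm_piExp, mul_one]
    · exact Filter.Eventually.of_forall fun t _ => (summable_norm_fcoef hF hper).mul_right _
    · simp only [tsum_mul_right]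
      exact Continuous.intervalIntegrable (by fun_prop) _ _
    · refine Filter.Eventually.of_forall fun t ht => ?_
      rw [Set.uIoc_of_le (by linarith [Real.pi_pos])] at ht
      exact (hasSum_fcoef_mul_piExp hF hper ⟨ht.1.le, ht.2⟩).mul_right _
  have hterm : ∀ m, fcoef F m * fcoef G (k - m) = 1 / Real.pi *
      ∫ t in -(Real.pi / 2)..(Real.pi / 2), fcoef F m * piExp m t * (G t * piExp (-k) t) := by
    intro m
    have e : ∀ t, fcoef F m * piExp m t * (G t * piExp (-k) t) =
        fcoef F m * (G t * piExp (-(k - m)) t) := by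
      intro t
      rw [show -(k - m) = m + -k by ring, piExp_add]; ring
    simp only [e]
    rw [intervalIntegral.integral_const_mul]
    conv_lhs => enter [2]; rw [fcoef]
    ring
  have hlim : fcoef (fun t => F t * G t) k = 1 / Real.pi *
      ∫ t in -(Real.pi / 2)..(Real.pi / 2), F t * (G t * piExp (-k) t) := by
    simp only [fcoef, mul_assoc]
  rw [hlim, funext hterm]
  exact h.mul_left _

/-! ### Fourier coefficients of the exponential factor: the function G -/

/-- The vertical factor `e^{-j z sin t}` of the array response at elevation `t` above broadside. -/
noncomputable def expSin (z t : ℝ) : ℂ := Complex.exp (Complex.I * (z * Real.sin (-t) : ℝ))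

/-- The horizontal factor `J_n(z cos t)` of the array response. -/
noncomputable def besselCos (n : ℕ) (z t : ℝ) : ℂ := besselNat n (z * Real.cos t : ℝ)

theorem contDiff_expSin (z : ℝ) : ContDiff ℝ 2 (expSin z) := by
  unfold expSin
  refine (contDiff_const.mul (Complex.ofRealCLM.contDiff.comp ?_)).cexp
  exact contDiff_const.mul (Real.contDiff_sin.comp contDiff_neg)

theorem contDiff_besselCos (n : ℕ) (z : ℝ) : ContDiff ℝ 2 (besselCos n z) := by
  unfold besselCos
  have h1 : ContDiff ℝ 2 (besselNat n) :=
    ((differentiable_besselNat n).contDiff (n := 2)).restrict_scalars ℝ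
  exact h1.comp (Complex.ofRealCLM.contDiff.comp (contDiff_const.mul Real.contDiff_cos))

theorem besselCos_endpoints (n : ℕ) (z : ℝ) :
    besselCos n z (Real.pi / 2) = besselCos n z (-(Real.pi / 2)) := by
  simp [besselCos]

/-- The mean of `e^{-jqt}` over the interval `[-π/2, π/2]`. -/
noncomputable def halfMean (q : ℤ) : ℂ :=
  1 / Real.pi * ∫ t in -(Real.pi / 2)..(Real.pi / 2), Complex.exp (Complex.I * q * (-t : ℝ))

theorem halfMean_even (r : ℤ) : halfMean (2 * r) = if r = 0 then 1 else 0 := by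
  have h : halfMean (2 * r) = fcoef (fun _ => 1) r := by
    rw [halfMean, fcoef]
    congr 2
    ext t
    rw [piExp, one_mul]; congr 1; push_cast; ring
  rw [h]
  split_ifs with hr
  · have hpi : (Real.pi : ℂ) ≠ 0 := by exact_mod_cast Real.pi_ne_zero
    subst hr
    simp [fcoef, piExp_zero, hpi]
  · exact fcoef_one hr

theorem halfMean_odd (r : ℤ) : halfMean (2 * r + 1) = 2 * (-1) ^ r / (Real.pi * (2 * r + 1)) := by
  have hq : ((2 * r + 1 : ℤ) : ℂ) ≠ 0 := by
    have : (2 * r + 1 : ℤ) ≠ 0 := by omega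
    exact_mod_cast this
  have hI := Complex.I_ne_zero
  have hpi : (Real.pi : ℂ) ≠ 0 := by exact_mod_cast Real.pi_ne_zero
  have e : ∀ t : ℝ, Complex.I * (2 * r + 1 : ℤ) * (-t : ℝ) =
      (-(Complex.I * (2 * r + 1 : ℤ))) * t := fun t => by push_cast; ring
  simp only [halfMean, e]
  rw [integral_exp_mul_complex (neg_ne_zero.2 (mul_ne_zero hI hq))]
  have hp : ∀ k : ℤ, Complex.exp (k * (Real.pi * Complex.I)) = (-1) ^ k := fun k => by
    rw [Complex.exp_int_mul, Complex.exp_pi_mul_I]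
  have e1 : Complex.exp (-(Complex.I * (2 * r + 1 : ℤ)) * ((Real.pi / 2 : ℝ) : ℂ)) =
      (-1) ^ r * -Complex.I := by
    rw [show -(Complex.I * (2 * r + 1 : ℤ)) * ((Real.pi / 2 : ℝ) : ℂ) =
      ((-r : ℤ) : ℂ) * (Real.pi * Complex.I) + -Real.pi / 2 * Complex.I by push_cast; ring,
      Complex.exp_add, hp, Complex.exp_neg_pi_div_two_mul_I, zpow_neg, ← inv_zpow]
    norm_num
  have e2 : Complex.exp (-(Complex.I * (2 * r + 1 : ℤ)) * ((-(Real.pi / 2) : ℝ) : ℂ)) =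
      (-1) ^ r * Complex.I := by
    rw [show -(Complex.I * (2 * r + 1 : ℤ)) * ((-(Real.pi / 2) : ℝ) : ℂ) =
      (r : ℂ) * (Real.pi * Complex.I) + (Real.pi / 2) * Complex.I by push_cast; ring,
      Complex.exp_add, hp, Complex.exp_pi_div_two_mul_I]
  rw [e1, e2]
  push_cast at hq ⊢
  field_simp
  ring

/-- Jacobi–Anger for e^{-jz sin t}, integrated termwise against e^{-2jkt}. -/
theorem hasSum_besselInt_mul_halfMean (z : ℝ) (k : ℤ) :
    HasSum (fun m : ℤ => besselInt m z * halfMean (m + 2 * k)) (fcoef (expSin z) k) := by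
  have h : HasSum (fun m : ℤ => ∫ t in -(Real.pi / 2)..(Real.pi / 2),
      besselInt m z * Complex.exp (Complex.I * m * (-t : ℝ)) * piExp (-k) t)
      (∫ t in -(Real.pi / 2)..(Real.pi / 2), expSin z t * piExp (-k) t) := by
    refine intervalIntegral.hasSum_integral_of_dominated_convergence
      (fun m _ => ‖besselInt m z‖) (fun m => ?_) (fun m => ?_) ?_ ?_ ?_
    · have h2 := continuous_piExp (-k)
      exact Continuous.aestronglyMeasurable (by fun_prop)
    · refine Filter.Eventually.of_forall fun t _ => le_of_eq ?_
      rw [norm_mul, norm_mul, norm_piExp,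
        show Complex.I * m * (-t : ℝ) = ((m * -t : ℝ) : ℂ) * Complex.I by push_cast; ring,
        Complex.norm_exp_ofReal_mul_I, mul_one, mul_one]
    · exact Filter.Eventually.of_forall fun t _ => summable_norm_besselInt z
    · exact intervalIntegrable_const
    · exact Filter.Eventually.of_forall fun t _ => (hasSum_besselInt_exp z (-t)).mul_right _
  have hterm : ∀ m : ℤ, besselInt m z * halfMean (m + 2 * k) = 1 / Real.pi *
      ∫ t in -(Real.pi / 2)..(Real.pi / 2),
        besselInt m z * Complex.exp (Complex.I * m * (-t : ℝ)) * piExp (-k) t := by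
    intro m
    have e : ∀ t : ℝ, besselInt m z * Complex.exp (Complex.I * m * (-t : ℝ)) * piExp (-k) t =
        besselInt m z * Complex.exp (Complex.I * (m + 2 * k : ℤ) * (-t : ℝ)) := by
      intro t
      rw [piExp, mul_assoc, ← Complex.exp_add]; congr 2; push_cast; ring
    simp only [e]
    rw [intervalIntegral.integral_const_mul, halfMean]
    ring
  rw [funext hterm]
  exact h.mul_left _

theorem besselInt_natCast (n : ℕ) (z : ℂ) : besselInt n z = besselNat n z := by
  simp [besselInt]

theorem besselInt_neg_natCast (n : ℕ) (z : ℂ) : besselInt (-n) z = (-1) ^ n * besselNat n z := by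
  have : min (-(n : ℤ)) 0 = -n := by omega
  rw [besselInt, this, zpow_neg, ← inv_zpow, Int.natAbs_neg, Int.natAbs_natCast]
  norm_num

/-- The orders ±(2k-1) are paired: J_{-m} = -J_m for odd m, and the two half-period means combine by
partial fractions. -/
theorem gTerm_eq (n₁ n₂ : ℤ) (z : ℝ) (k : ℕ+) :
    4 / Real.pi * gTerm n₁ n₂ z k =
      besselInt (2 * k - 1 : ℕ) z * halfMean ((2 * k - 1 : ℕ) + 2 * (n₁ + n₂)) +
      besselInt (-(2 * k - 1 : ℕ)) z * halfMean (-(2 * k - 1 : ℕ) + 2 * (n₁ + n₂)) := by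
  have hk : 1 ≤ (k : ℕ) := k.2
  have hc : ((2 * k - 1 : ℕ) : ℤ) = 2 * (k : ℕ) - 1 := by omega
  have hcR : ((2 * k - 1 : ℕ) : ℝ) = 2 * (k : ℕ) - 1 := by
    rw [Nat.cast_sub (by omega)]; push_cast; ring
  have hodd : (-1 : ℂ) ^ (2 * (k : ℕ) - 1) = -1 :=
    Odd.neg_one_pow ⟨k - 1, by omega⟩
  rw [besselInt_neg_natCast, besselInt_natCast, hodd, gTerm, ← hcR, besselJ_natCast, hc,
    show (2 * ((k : ℕ) : ℤ) - 1 + 2 * (n₁ + n₂)) = 2 * ((k : ℕ) + (n₁ + n₂) - 1) + 1 by ring,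
    show (-(2 * ((k : ℕ) : ℤ) - 1) + 2 * (n₁ + n₂)) = 2 * (n₁ + n₂ - (k : ℕ)) + 1 by ring,
    halfMean_odd, halfMean_odd]
  have hs1 : (-1 : ℂ) ^ (((k : ℕ) : ℤ) + (n₁ + n₂) - 1) = -(-1) ^ (((k : ℕ) : ℤ) - n₁ - n₂) := by
    rw [show ((k : ℕ) : ℤ) + (n₁ + n₂) - 1 = ((k : ℕ) - n₁ - n₂) + 2 * (n₁ + n₂) - 1 by ring,
      zpow_sub₀ (by norm_num), zpow_add₀ (by norm_num), zpow_mul]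
    norm_num [div_neg]
  have hs2 : (-1 : ℂ) ^ (n₁ + n₂ - ((k : ℕ) : ℤ)) = (-1) ^ (((k : ℕ) : ℤ) - n₁ - n₂) := by
    rw [show n₁ + n₂ - ((k : ℕ) : ℤ) = -((k : ℕ) - n₁ - n₂) by ring, zpow_neg, ← inv_zpow]
    norm_num
  rw [hs1, hs2]
  have hd1 : (2 * ((k : ℕ) : ℂ) - 1 + 2 * (n₁ + n₂)) ≠ 0 := by
    have : (2 * ((k : ℕ) : ℤ) - 1 + 2 * (n₁ + n₂)) ≠ 0 := by omega
    exact_mod_cast this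
  have hd2 : (2 * ((k : ℕ) : ℂ) - 1 - 2 * (n₁ + n₂)) ≠ 0 := by
    have : (2 * ((k : ℕ) : ℤ) - 1 - 2 * (n₁ + n₂)) ≠ 0 := by omega
    exact_mod_cast this
  have hpi : (Real.pi : ℂ) ≠ 0 := by exact_mod_cast Real.pi_ne_zero
  push_cast
  rw [show (2 * ((k : ℕ) : ℂ) - 1) ^ 2 - 4 * (n₁ + n₂) ^ 2 =
    (2 * ((k : ℕ) : ℂ) - 1 + 2 * (n₁ + n₂)) * (2 * ((k : ℕ) : ℂ) - 1 - 2 * (n₁ + n₂)) by ring,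
    show 2 * (((k : ℕ) : ℂ) + (n₁ + n₂) - 1) + 1 = 2 * ((k : ℕ) : ℂ) - 1 + 2 * (n₁ + n₂) by ring,
    show 2 * ((n₁ : ℂ) + n₂ - (k : ℕ)) + 1 = -(2 * ((k : ℕ) : ℂ) - 1 - 2 * (n₁ + n₂)) by ring]
  field_simp
  ring

/-- Among even orders only m = -2K has a nonzero half-period mean and gives J_{2K}, which `b`
removes. The odd orders, paired by sign, form the series in G. -/
theorem hasSum_gTerm (n₁ n₂ : ℤ) (z : ℝ) :
    HasSum (fun k : ℕ+ => 4 / Real.pi * gTerm n₁ n₂ z k)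
      (fcoef (expSin z) (n₁ + n₂) - besselJ (2 * (n₁ + n₂)) z) := by
  set K := n₁ + n₂ with hK
  have hJ : besselJ (2 * (n₁ + n₂)) z = besselNat (2 * K).natAbs z := by
    rw [← besselJ_even_intCast, hK]; push_cast; rfl
  set f : ℤ → ℂ := fun m => besselInt m z * halfMean (m + 2 * K) with hf
  set b : ℤ → ℂ := fun m => f m - if m = -(2 * K) then besselNat (2 * K).natAbs z else 0 with hb
  have hbsum : HasSum b (fcoef (expSin z) K - besselNat (2 * K).natAbs z) :=
    (hasSum_besselInt_mul_halfMean z K).sub (hasSum_ite_eq _ _)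
  have hbeven : ∀ r : ℤ, b (2 * r) = 0 := by
    intro r
    simp only [hb, hf]
    rw [← mul_add, halfMean_even]
    by_cases hr : r + K = 0
    · have hr' : 2 * r = -(2 * K) := by omega
      have hs : (-1 : ℂ) ^ (min (2 * r) 0) = 1 := by
        refine Even.neg_one_zpow ?_
        rcases min_choice (2 * r) 0 with h | h <;> rw [h]
        · exact even_two_mul r
        · exact Even.zero
      rw [if_pos hr, if_pos hr', besselInt, hs, hr', Int.natAbs_neg]
      ring
    · rw [if_neg hr, if_neg (by omega)]
      ring
  have h1 := hbsum.nat_add_neg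
  rw [show b 0 = 0 by simpa using hbeven 0, add_zero] at h1
  have hinj : Function.Injective fun k : ℕ+ => 2 * (k : ℕ) - 1 := by
    intro i j hij
    have h1 := i.2
    have h2 := j.2
    have : (i : ℕ) = j := by simp only at hij; omega
    exact PNat.eq this
  rw [← hinj.hasSum_iff] at h1
  · rw [hJ]
    convert h1 using 1
    ext k
    have hne : ∀ m : ℤ, Odd m → b m = f m := by
      rintro m ⟨r, hr⟩
      simp only [hb]
      rw [if_neg (by omega), sub_zero]
    have hk : 0 < (k : ℕ) := k.pos
    have hc : ((2 * k - 1 : ℕ) : ℤ) = 2 * (((k : ℕ) : ℤ) - 1) + 1 := by omega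
    have ho : Odd ((2 * k - 1 : ℕ) : ℤ) := ⟨_, hc⟩
    simp only [Function.comp_apply]
    rw [gTerm_eq, hne _ ho, hne _ ho.neg]
  · intro n hn
    rcases Nat.even_or_odd' n with ⟨r, rfl | rfl⟩
    · have e1 := hbeven r
      have e2 := hbeven (-r)
      rw [mul_neg] at e2
      push_cast
      rw [e1, e2, add_zero]
    · exact absurd ⟨⟨r + 1, r.succ_pos⟩, by simp; omega⟩ hn

theorem summable_gTerm (n₁ n₂ : ℤ) (z : ℝ) : Summable (gTerm n₁ n₂ z) := by
  have hpi : (4 / Real.pi : ℂ) ≠ 0 := by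
    have : (Real.pi : ℂ) ≠ 0 := by exact_mod_cast Real.pi_ne_zero
    exact div_ne_zero (by norm_num) this
  exact (summable_mul_left_iff hpi).1 (hasSum_gTerm n₁ n₂ z).summable

theorem gFun_eq (n₁ n₂ : ℤ) (z : ℝ) : gFun n₁ n₂ z = fcoef (expSin z) (n₁ + n₂) := by
  rw [gFun, ← tsum_mul_left, (hasSum_gTerm n₁ n₂ z).tsum_eq]
  ring

/-! ### Summing V from the inside out -/

theorem vTerm_eq (n n₁ n₂ : ℤ) (z₁ z₂ : ℝ) : vTerm n n₁ n₂ z₁ z₂ =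
    fcoef (besselCos n.natAbs z₁) (-n₂) * fcoef (expSin z₂) (n₁ - -n₂) := by
  have hn : |(n : ℝ)| = (n.natAbs : ℝ) := by rw [Nat.cast_natAbs, Int.cast_abs]
  rw [vTerm, gFun_eq, sub_neg_eq_add, hn, besselJ_mul_besselJ]
  congr 1
  rw [fcoef, neg_neg]
  rfl

/-- This is the convolution formula with index m = -n̂. The Bessel factor can play the role of the
function with equal end values since cos vanishes at ±π/2. -/
theorem hasSum_vTerm (n n₁ : ℤ) (z₁ z₂ : ℝ) : HasSum (fun n₂ => vTerm n n₁ n₂ z₁ z₂)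
    (fcoef (fun t => besselCos n.natAbs z₁ t * expSin z₂ t) n₁) := by
  have h := hasSum_fcoef_mul (contDiff_besselCos n.natAbs z₁) (besselCos_endpoints _ _)
    (contDiff_expSin z₂).continuous n₁
  rw [← (Equiv.neg ℤ).hasSum_iff] at h
  rw [funext fun n₂ => vTerm_eq n n₁ n₂ z₁ z₂]
  exact h

theorem chiCF_two_mul (ν : Measure ℝ) (k : ℤ) :
    chiCF ν (2 * k) = ∫ θ, piExp k (θ - Real.pi / 2) ∂ν := by
  rw [chiCF, charFun_apply_real, integral_map (by fun_prop) (by fun_prop)]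
  congr 1
  ext θ
  rw [piExp]; congr 1; push_cast; ring

/-- The Fourier partial sums are integrated against the elevation law by dominated convergence.
Absolute continuity discards θ = 0 and θ = π, where the Fourier series may miss the value of F. -/
theorem hasSum_vMid (ν : Measure ℝ) [IsProbabilityMeasure ν] (hν : ν ≪ volume)
    (hνπ : ∀ᵐ θ ∂ν, θ ∈ Set.Icc 0 Real.pi) (n : ℤ) (z₁ z₂ : ℝ) :
    HasSum (fun n₁ => vMid ν n n₁ z₁ z₂)
      (∫ θ, besselCos n.natAbs z₁ (θ - Real.pi / 2) * expSin z₂ (θ - Real.pi / 2) ∂ν)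
      (symmetricIcc ℤ) := by
  set F : ℝ → ℂ := fun t => besselCos n.natAbs z₁ t * expSin z₂ t with hF
  have hFc : ContDiff ℝ 2 F := (contDiff_besselCos _ _).mul (contDiff_expSin _)
  have hmid : ∀ n₁, vMid ν n n₁ z₁ z₂ =
      ∫ θ, fcoef F n₁ * piExp n₁ (θ - Real.pi / 2) ∂ν := by
    intro n₁
    rw [vMid, (hasSum_vTerm n n₁ z₁ z₂).tsum_eq, chiCF_two_mul, integral_const_mul, mul_comm]
  have hcont : ∀ k : ℤ, Continuous fun θ : ℝ => fcoef F k * piExp k (θ - Real.pi / 2) := fun k =>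
    continuous_const.mul ((continuous_piExp k).comp (by fun_prop))
  have hint : ∀ k : ℤ, Integrable (fun θ : ℝ => fcoef F k * piExp k (θ - Real.pi / 2)) ν := fun k =>
    Integrable.of_bound (hcont k).aestronglyMeasurable ‖fcoef F k‖
      (Filter.Eventually.of_forall fun θ => by rw [norm_mul, norm_piExp, mul_one])
  have hint_ae : ∀ᵐ θ ∂ν, θ - Real.pi / 2 ∈ Set.Ioo (-(Real.pi / 2)) (Real.pi / 2) := by
    have hne : ∀ x : ℝ, ∀ᵐ θ ∂ν, θ ≠ x := fun x => hν.ae_le (Measure.ae_ne volume x)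
    filter_upwards [hνπ, hne 0, hne Real.pi] with θ h h0 hp
    have h1 := lt_of_le_of_ne h.1 (Ne.symm h0)
    have h2 := lt_of_le_of_ne h.2 hp
    constructor <;> linarith
  obtain ⟨C, hC⟩ := fourier_bounded_convergence hFc
  rw [hasSum_symmetricIcc_iff]
  simp only [hmid]
  simp only [← integral_finsetSum _ fun k _ => hint k]
  refine tendsto_integral_of_dominated_convergence (fun _ => C) (fun N => ?_)
    (integrable_const _) (fun N => ?_) ?_
  · exact (continuous_finsetSum _ fun k _ => hcont k).aestronglyMeasurable
  · filter_upwards [hint_ae] with θ hθ using (hC _ hθ).1 N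
  · filter_upwards [hint_ae] with θ hθ using (hC _ hθ).2

/-- The response `e^{j(z₁ sin θ sin(φ + A) + z₂ cos θ)}` of a pair of antennas. -/
noncomputable def pairResponse (A z₁ z₂ : ℝ) (q : ℝ × ℝ) : ℂ :=
  Complex.exp (Complex.I *
    (z₁ * Real.sin q.2 * Real.sin (q.1 + A) + z₂ * Real.cos q.2 : ℝ))

theorem vOut_eq (μ ν : Measure ℝ) [IsProbabilityMeasure μ] [IsProbabilityMeasure ν]
    (hν : ν ≪ volume)
    (hνπ : ∀ᵐ θ ∂ν, θ ∈ Set.Icc 0 Real.pi) (n : ℤ) (A z₁ z₂ : ℝ) :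
    vOut μ ν n A z₁ z₂ = ∫ q, besselInt n (z₁ * Real.sin q.2 : ℝ) *
      Complex.exp (Complex.I * n * (q.1 + A : ℝ)) *
      Complex.exp (Complex.I * (z₂ * Real.cos q.2 : ℝ)) ∂(μ.prod ν) := by
  rw [vOut, (hasSum_vMid ν hν hνπ n z₁ z₂).tsum_eq, psiCF, charFun_apply_real, mul_assoc,
    ← integral_prod_mul, ← integral_const_mul]
  refine integral_congr_ae (Filter.Eventually.of_forall fun q => ?_)
  dsimp only
  rw [besselInt, besselCos, expSin, Real.cos_sub_pi_div_two, neg_sub, Real.sin_pi_div_two_sub,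
    show Complex.I * n * (q.1 + A : ℝ) = Complex.I * n * A + (n : ℝ) * q.1 * Complex.I by
      push_cast; ring, Complex.exp_add]
  ring

/-- Jacobi–Anger at the angle φ + A, integrated termwise; |z₁ sin θ| ≤ |z₁| makes the bound on the
Bessel factors independent of the angles. -/
theorem hasSum_vOut (μ ν : Measure ℝ) [IsProbabilityMeasure μ] [IsProbabilityMeasure ν]
    (hν : ν ≪ volume)
    (hνπ : ∀ᵐ θ ∂ν, θ ∈ Set.Icc 0 Real.pi) (A z₁ z₂ : ℝ) :
    HasSum (fun n => vOut μ ν n A z₁ z₂) (∫ q, pairResponse A z₁ z₂ q ∂(μ.prod ν)) := by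
  rw [funext fun n => vOut_eq μ ν hν hνπ n A z₁ z₂]
  have hnorm : ∀ x : ℝ, ‖Complex.exp (Complex.I * (x : ℂ))‖ = 1 := fun x => by
    rw [mul_comm, Complex.norm_exp_ofReal_mul_I]
  refine hasSum_integral_of_dominated_convergence
    (fun n _ => |z₁ / 2| ^ n.natAbs / (Nat.factorial n.natAbs : ℝ) * Real.exp (|z₁ / 2| ^ 2))
    (fun n => ?_) (fun n => ?_) ?_ ?_ ?_
  · have := (differentiable_besselNat n.natAbs).continuous
    unfold besselInt
    exact Continuous.aestronglyMeasurable (by fun_prop)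
  · refine Filter.Eventually.of_forall fun q => ?_
    rw [norm_mul, norm_mul, hnorm, mul_one,
      show Complex.I * n * (q.1 + A : ℝ) = Complex.I * ((n * (q.1 + A) : ℝ) : ℂ) by
        push_cast; ring, hnorm, mul_one, norm_besselInt]
    refine (norm_besselNat_le _ _).trans ?_
    have : ‖((z₁ * Real.sin q.2 : ℝ) : ℂ) / 2‖ ≤ |z₁ / 2| := by
      rw [norm_div, Complex.norm_real, Complex.norm_ofNat, Real.norm_eq_abs, abs_mul, abs_div,
        abs_two]
      have := mul_le_of_le_one_right (abs_nonneg z₁) (Real.abs_sin_le_one q.2)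
      gcongr
    gcongr
  · exact Filter.Eventually.of_forall fun q => summable_norm_besselNat_bound _
  · exact integrable_const _
  · refine Filter.Eventually.of_forall fun q => ?_
    have h := (hasSum_besselInt_exp (z₁ * Real.sin q.2) (q.1 + A)).mul_right
      (Complex.exp (Complex.I * (z₂ * Real.cos q.2 : ℝ)))
    rw [← Complex.exp_add] at h
    rw [pairResponse, Complex.ofReal_add (_ * _), mul_add]
    exact h

theorem vConverges (μ ν : Measure ℝ) [IsProbabilityMeasure μ] [IsProbabilityMeasure ν]
    (hν : ν ≪ volume)
    (hνπ : ∀ᵐ θ ∂ν, θ ∈ Set.Icc 0 Real.pi) (A z₁ z₂ : ℝ) : VConverges μ ν A z₁ z₂ :=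
  ⟨fun n₁ n₂ => summable_gTerm n₁ n₂ z₂, fun n n₁ => (hasSum_vTerm n n₁ z₁ z₂).summable,
    fun n => (hasSum_vMid ν hν hνπ n z₁ z₂).summable, (hasSum_vOut μ ν hν hνπ A z₁ z₂).summable⟩

theorem vSeries_eq_integral (μ ν : Measure ℝ) [IsProbabilityMeasure μ] [IsProbabilityMeasure ν]
    (hν : ν ≪ volume)
    (hνπ : ∀ᵐ θ ∂ν, θ ∈ Set.Icc 0 Real.pi) (A z₁ z₂ : ℝ) :
    vSeries μ ν A z₁ z₂ = ∫ q, pairResponse A z₁ z₂ q ∂(μ.prod ν) :=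
  (hasSum_vOut μ ν hν hνπ A z₁ z₂).tsum_eq

/-! ### Mean interference in terms of antenna correlations -/

theorem Measurable.complex_star {α : Type*} [MeasurableSpace α] {f : α → ℂ} (hf : Measurable f) :
    Measurable fun x => star (f x) :=
  Complex.continuous_conj.measurable.comp hf

theorem integral_exp_int_mul_of_isUniform {Ω : Type*} [MeasurableSpace Ω] {P : Measure Ω}
    {X : Ω → ℝ} (hX : Measurable X)
    (hu : pdf.IsUniform X (Set.Icc 0 (2 * Real.pi)) P volume) {n : ℤ} (hn : n ≠ 0) :
    ∫ ω, Complex.exp (Complex.I * n * X ω) ∂P = 0 := by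
  have h1 : ∫ ω, Complex.exp (Complex.I * n * X ω) ∂P =
      ∫ x : ℝ, Complex.exp (Complex.I * n * x) ∂(P.map X) := by
    rw [integral_map hX.aemeasurable (by fun_prop)]
  rw [h1, hu, ProbabilityTheory.cond, integral_smul_measure, integral_Icc_eq_integral_Ioc,
    ← intervalIntegral.integral_of_le (by positivity),
    integral_exp_mul_complex (mul_ne_zero Complex.I_ne_zero (by exact_mod_cast hn))]
  have : Complex.exp (Complex.I * n * ((2 * Real.pi : ℝ) : ℂ)) = 1 := by
    rw [show Complex.I * n * ((2 * Real.pi : ℝ) : ℂ) = n * (2 * Real.pi * Complex.I) by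
      push_cast; ring, Complex.exp_int_mul_two_pi_mul_I]
  rw [this]
  simp

namespace RayModel

variable {Ω : Type*} [MeasurableSpace Ω] {P : Measure Ω} {μ ν : Measure ℝ} {L C S : ℕ}

/-- The relative phase factor of a ray of user `l` and a ray of user `l'`. -/
noncomputable def phaseFactor (R : RayModel P μ ν L C S) (l l' : Fin L)
    (p : (Fin C × Fin S) × (Fin C × Fin S)) (ω : Ω) : ℂ :=
  Complex.exp (Complex.I * (R.phase l' p.2 ω - R.phase l p.1 ω : ℝ))

theorem norm_phaseFactor (R : RayModel P μ ν L C S) (l l' : Fin L)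
    (p : (Fin C × Fin S) × (Fin C × Fin S)) (ω : Ω) : ‖R.phaseFactor l l' p ω‖ = 1 := by
  rw [phaseFactor, mul_comm, Complex.norm_exp_ofReal_mul_I]

theorem integral_phaseFactor_mul_star [IsProbabilityMeasure P] (R : RayModel P μ ν L C S)
    {l l' : Fin L} (hll' : l ≠ l') (p q : (Fin C × Fin S) × (Fin C × Fin S)) :
    ∫ ω, R.phaseFactor l l' p ω * star (R.phaseFactor l l' q ω) ∂P = if p = q then 1 else 0 := by
  split_ifs with hpq
  · subst hpq
    have : ∀ ω, R.phaseFactor l l' p ω * star (R.phaseFactor l l' p ω) = 1 := fun ω => by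
      rw [Complex.star_def, Complex.mul_conj, Complex.normSq_eq_norm_sq, norm_phaseFactor]
      norm_num
    simp only [this, integral_const, probReal_univ, one_smul]
  -- The integer `n x` is the net exponent of the phase `x` in the product. For p ≠ q some exponent
  -- is nonzero, and that factor has mean zero; l ≠ l' prevents cancellation between users.
  · set n : Fin L × (Fin C × Fin S) → ℤ := fun x =>
      (if x = (l', p.2) then 1 else 0) - (if x = (l, p.1) then 1 else 0) -
        (if x = (l', q.2) then 1 else 0) + (if x = (l, q.1) then 1 else 0) with hn
    have hprod : ∀ ω, R.phaseFactor l l' p ω * star (R.phaseFactor l l' q ω) =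
        ∏ x, Complex.exp (Complex.I * n x * R.phase x.1 x.2 ω) := by
      intro ω
      have hsum : ∑ x, (n x : ℂ) * R.phase x.1 x.2 ω = R.phase l' p.2 ω - R.phase l p.1 ω -
          R.phase l' q.2 ω + R.phase l q.1 ω := by
        simp only [hn]
        push_cast
        simp only [add_mul, sub_mul, Finset.sum_add_distrib, Finset.sum_sub_distrib, ite_mul,
          one_mul, zero_mul, Finset.sum_ite_eq', Finset.mem_univ, if_true]
      rw [← Complex.exp_sum]
      simp only [mul_assoc]
      rw [← Finset.mul_sum, hsum, phaseFactor, phaseFactor, Complex.star_def, ← Complex.exp_conj,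
        ← Complex.exp_add]
      congr 1
      rw [map_mul, Complex.conj_I, Complex.conj_ofReal]
      push_cast
      ring
    simp only [hprod]
    rw [R.phase_iIndep.integral_fun_prod_comp
      (f := fun x (y : ℝ) => Complex.exp (Complex.I * n x * y))
      (fun x => (R.measurable_phase x.1 x.2).aemeasurable) (fun x => by fun_prop)]
    obtain ⟨x, hx⟩ : ∃ x, n x ≠ 0 := by
      by_cases h1 : p.1 = q.1
      · have h2 : p.2 ≠ q.2 := fun h => hpq (Prod.ext h1 h)
        exact ⟨(l', p.2), by simp [hn, h2, hll'.symm]⟩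
      · exact ⟨(l, p.1), by simp [hn, h1, hll']⟩
    exact Finset.prod_eq_zero (Finset.mem_univ x)
      (integral_exp_int_mul_of_isUniform (R.measurable_phase x.1 x.2) (R.phase_uniform x.1 x.2) hx)

variable {ι : Type*} [Fintype ι]

/-- The inner product of the steering vectors in the directions `x` and `y`. -/
noncomputable def steerInner (a : ℝ → ℝ → ι → ℂ) (x y : ℝ × ℝ) : ℂ :=
  ∑ m, star (a x.1 x.2 m) * a y.1 y.2 m

/-- The direction of arrival of a ray. -/
def angles (R : RayModel P μ ν L C S) (l : Fin L) (r : Fin C × Fin S) (ω : Ω) : ℝ × ℝ :=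
  (R.azimuth l r ω, R.elevation l r ω)

theorem measurable_angles (R : RayModel P μ ν L C S) (l : Fin L) (r : Fin C × Fin S) :
    Measurable (R.angles l r) :=
  (R.measurable_azimuth l r).prodMk (R.measurable_elevation l r)

theorem dotProduct_channel (R : RayModel P μ ν L C S) (a : ℝ → ℝ → ι → ℂ) (l l' : Fin L) (ω : Ω) :
    star (R.channel a l ω) ⬝ᵥ R.channel a l' ω =
      ∑ p : (Fin C × Fin S) × (Fin C × Fin S),
        ((Real.sqrt (R.power l p.1) * Real.sqrt (R.power l' p.2) : ℝ) : ℂ) *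
          (R.phaseFactor l l' p ω * steerInner a (R.angles l p.1 ω) (R.angles l' p.2 ω)) := by
  have hU : ∀ r r', R.phaseFactor l l' (r, r') ω =
      star (Complex.exp (Complex.I * R.phase l r ω)) * Complex.exp (Complex.I * R.phase l' r' ω) := by
    intro r r'
    rw [phaseFactor, Complex.star_def, ← Complex.exp_conj, ← Complex.exp_add]
    congr 1
    rw [map_mul, Complex.conj_I, Complex.conj_ofReal]
    push_cast
    ring
  simp only [dotProduct, channel, Pi.star_apply, star_sum, Finset.sum_mul_sum]
  simp only [steerInner, angles, Finset.mul_sum]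
  rw [Fintype.sum_prod_type, Finset.sum_comm]
  refine Finset.sum_congr rfl fun r _ => ?_
  rw [Finset.sum_comm]
  refine Finset.sum_congr rfl fun r' _ => Finset.sum_congr rfl fun m _ => ?_
  rw [hU, star_mul', star_mul', Complex.star_def, Complex.conj_ofReal]
  push_cast
  ring

theorem map_angles [IsProbabilityMeasure P] (R : RayModel P μ ν L C S) {l l' : Fin L}
    (hll' : l ≠ l') (r r' : Fin C × Fin S) : P.map (R.angles l r) = μ.prod ν := by
  have h := (R.angles_iIndep l l' hll' r r').indepFun (i := 0) (j := 1) (by decide)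
  have h' : IndepFun (R.azimuth l r) (R.elevation l r) P := h
  have h2 := (indepFun_iff_map_prod_eq_prod_map_map (R.measurable_azimuth l r).aemeasurable
    (R.measurable_elevation l r).aemeasurable).1 h'
  rwa [R.azimuth_law l r, R.elevation_law l r] at h2

theorem indepFun_angles (R : RayModel P μ ν L C S) {l l' : Fin L}
    (hll' : l ≠ l') (r r' : Fin C × Fin S) : IndepFun (R.angles l r) (R.angles l' r') P := by
  have h := (R.angles_iIndep l l' hll' r r').indepFun_prodMk_prodMk (fun i => by
    fin_cases i
    · exact R.measurable_azimuth l r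
    · exact R.measurable_elevation l r
    · exact R.measurable_azimuth l' r'
    · exact R.measurable_elevation l' r') 0 1 2 3 (by decide) (by decide) (by decide) (by decide)
  exact h

/-- The correlation of two antennas. -/
noncomputable def antennaCorr (a : ℝ → ℝ → ι → ℂ) (μ ν : Measure ℝ) (m m' : ι) : ℂ :=
  ∫ q, a q.1 q.2 m * star (a q.1 q.2 m') ∂(μ.prod ν)

/-- The squared inner product is a double sum over antennas of a function of one direction times the
conjugate of the same function of the other. Independence and equality in law turn each mean into a
squared modulus. -/
theorem integral_steerInner_mul_star [IsProbabilityMeasure P] (R : RayModel P μ ν L C S)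
    {a : ℝ → ℝ → ι → ℂ} (ha : ∀ m, Measurable fun q : ℝ × ℝ => a q.1 q.2 m)
    (ha1 : ∀ φ θ m, ‖a φ θ m‖ = 1) {l l' : Fin L} (hll' : l ≠ l') (r r' : Fin C × Fin S) :
    ∫ ω, steerInner a (R.angles l r ω) (R.angles l' r' ω) *
        star (steerInner a (R.angles l r ω) (R.angles l' r' ω)) ∂P =
      ∑ m, ∑ m', ((‖antennaCorr a μ ν m m'‖ ^ 2 : ℝ) : ℂ) := by
  set f : ι → ι → ℝ × ℝ → ℂ := fun m m' q => a q.1 q.2 m * star (a q.1 q.2 m') with hf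
  have hfm : ∀ m m', Measurable (f m m') := fun m m' => (ha m).mul (ha m').complex_star
  have hfn : ∀ m m' q, ‖f m m' q‖ = 1 := fun m m' q => by simp [hf, ha1]
  have hexp : ∀ ω, steerInner a (R.angles l r ω) (R.angles l' r' ω) *
        star (steerInner a (R.angles l r ω) (R.angles l' r' ω)) =
      ∑ m, ∑ m', star (f m m' (R.angles l r ω)) * f m m' (R.angles l' r' ω) := by
    intro ω
    simp only [steerInner, star_sum, Finset.sum_mul_sum, hf]
    refine Finset.sum_congr rfl fun m _ => Finset.sum_congr rfl fun m' _ => ?_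
    simp only [star_mul', star_star]
    ring
  have hint : ∀ m m', Integrable
      (fun ω => star (f m m' (R.angles l r ω)) * f m m' (R.angles l' r' ω)) P := fun m m' => by
    refine Integrable.of_bound (C := 1) ?_ (Filter.Eventually.of_forall fun ω => ?_)
    · exact (((hfm m m').comp (R.measurable_angles l r)).complex_star.mul
        ((hfm m m').comp (R.measurable_angles l' r'))).aestronglyMeasurable
    · rw [norm_mul, norm_star, hfn, hfn, one_mul]
  simp only [hexp]
  rw [integral_finsetSum _ fun m _ => integrable_finsetSum _ fun m' _ => hint m m']
  refine Finset.sum_congr rfl fun m _ => ?_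
  rw [integral_finsetSum _ fun m' _ => hint m m']
  refine Finset.sum_congr rfl fun m' _ => ?_
  -- A second user is needed: independence of azimuth and elevation within a ray comes from the
  -- four-angle independence of two users.
  have hlaw : ∀ k r, (∃ k', k ≠ k') → ∫ ω, f m m' (R.angles k r ω) ∂P = antennaCorr a μ ν m m' := by
    rintro k r ⟨k', hk⟩
    rw [antennaCorr, ← R.map_angles hk r r, integral_map (R.measurable_angles k r).aemeasurable
      (hfm m m').aestronglyMeasurable]
  rw [(R.indepFun_angles hll' r r').integral_fun_comp_mul_comp
    (f := fun q => star (f m m' q)) (g := f m m')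
    (R.measurable_angles l r).aemeasurable (R.measurable_angles l' r').aemeasurable
    (hfm m m').complex_star.aestronglyMeasurable (hfm m m').aestronglyMeasurable, hlaw l' r' ⟨l, hll'.symm⟩]
  have hstar : ∫ ω, star (f m m' (R.angles l r ω)) ∂P = star (antennaCorr a μ ν m m') := by
    rw [← hlaw l r ⟨l', hll'⟩]
    exact integral_conj
  rw [hstar, Complex.star_def, ← Complex.normSq_eq_conj_mul_self, Complex.normSq_eq_norm_sq]

theorem integrable_interference [IsProbabilityMeasure P] (R : RayModel P μ ν L C S)
    {a : ℝ → ℝ → ι → ℂ} (ha : ∀ m, Measurable fun q : ℝ × ℝ => a q.1 q.2 m)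
    (ha1 : ∀ φ θ m, ‖a φ θ m‖ = 1) (l l' : Fin L) : Integrable (R.interference a l l') P := by
  have hch : ∀ k m, Measurable fun ω => R.channel a k ω m := by
    intro k m
    unfold channel
    refine Finset.measurable_sum _ fun r _ => ?_
    have h1 := R.measurable_phase k r
    have h2 := (ha m).comp (R.measurable_angles k r)
    exact (measurable_const.mul (by fun_prop)).mul h2
  have hchb : ∀ k m ω, ‖R.channel a k ω m‖ ≤ ∑ r, Real.sqrt (R.power k r) := by
    intro k m ω
    refine (norm_sum_le _ _).trans (Finset.sum_le_sum fun r _ => le_of_eq ?_)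
    rw [norm_mul, norm_mul, ha1, mul_comm Complex.I, Complex.norm_exp_ofReal_mul_I, mul_one,
      mul_one, Complex.norm_real, Real.norm_of_nonneg (Real.sqrt_nonneg _)]
  refine Integrable.of_bound
    (C := (∑ _m : ι, (∑ r, Real.sqrt (R.power l r)) * ∑ r, Real.sqrt (R.power l' r)) ^ 2) ?_
    (Filter.Eventually.of_forall fun ω => ?_)
  · refine (Measurable.pow_const (Measurable.norm ?_) 2).aestronglyMeasurable
    simp only [dotProduct, Pi.star_apply]
    exact Finset.measurable_sum _ fun m _ => (hch l m).complex_star.mul (hch l' m)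
  · rw [interference, Real.norm_of_nonneg (by positivity)]
    refine pow_le_pow_left₀ (norm_nonneg _) ?_ 2
    refine (norm_sum_le _ _).trans (Finset.sum_le_sum fun m _ => ?_)
    rw [norm_mul, Pi.star_apply, norm_star]
    exact mul_le_mul (hchb l m ω) (hchb l' m ω) (norm_nonneg _)
      (Finset.sum_nonneg fun r _ => Real.sqrt_nonneg _)

/-- Phases and angles factor, and the phase means alone kill the off-diagonal pairs of rays. Hence
dependence between angles of one user is harmless. -/
theorem integral_interference [IsProbabilityMeasure P] (R : RayModel P μ ν L C S)
    {a : ℝ → ℝ → ι → ℂ} (ha : ∀ m, Measurable fun q : ℝ × ℝ => a q.1 q.2 m)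
    (ha1 : ∀ φ θ m, ‖a φ θ m‖ = 1) {l l' : Fin L} (hll' : l ≠ l') :
    ∫ ω, R.interference a l l' ω ∂P =
      R.gain l * R.gain l' * ∑ m, ∑ m', ‖antennaCorr a μ ν m m'‖ ^ 2 := by
  set T := (Fin C × Fin S) × (Fin C × Fin S)
  set c : T → ℝ := fun p => Real.sqrt (R.power l p.1) * Real.sqrt (R.power l' p.2) with hc
  set U : T → Ω → ℂ := R.phaseFactor l l' with hU
  set Y : T → Ω → ℂ := fun p ω => steerInner a (R.angles l p.1 ω) (R.angles l' p.2 ω) with hY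
  have hexp : ∀ ω, (R.interference a l l' ω : ℂ) = ∑ p, ∑ q, ((c p * c q : ℝ) : ℂ) *
      ((U p ω * star (U q ω)) * (Y p ω * star (Y q ω))) := by
    intro ω
    rw [interference, ← Complex.normSq_eq_norm_sq, ← Complex.mul_conj, dotProduct_channel,
      ← Complex.star_def, star_sum, Finset.sum_mul_sum]
    refine Finset.sum_congr rfl fun p _ => Finset.sum_congr rfl fun q _ => ?_
    rw [star_mul', star_mul', Complex.star_def, Complex.conj_ofReal]
    simp only [hc, hU, hY]
    push_cast
    ring
  have hUm : ∀ p, Measurable (U p) := fun p => by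
    have h1 := R.measurable_phase l p.1
    have h2 := R.measurable_phase l' p.2
    simp only [hU]
    unfold phaseFactor
    fun_prop
  have hsm : ∀ (f g : Ω → ℝ × ℝ), Measurable f → Measurable g →
      Measurable fun ω => steerInner a (f ω) (g ω) := by
    intro f g hf hg
    unfold steerInner
    exact Finset.measurable_sum _ fun m _ => ((ha m).comp hf).complex_star.mul ((ha m).comp hg)
  have hYm : ∀ p, Measurable (Y p) := fun p =>
    hsm _ _ (R.measurable_angles l p.1) (R.measurable_angles l' p.2)
  have hYb : ∀ p ω, ‖Y p ω‖ ≤ Fintype.card ι := by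
    intro p ω
    refine (norm_sum_le _ _).trans (le_of_eq ?_)
    simp [ha1]
  have hint : ∀ p q, Integrable (fun ω => ((c p * c q : ℝ) : ℂ) *
      ((U p ω * star (U q ω)) * (Y p ω * star (Y q ω)))) P := by
    intro p q
    refine Integrable.const_mul (Integrable.of_bound
      (C := (Fintype.card ι : ℝ) * Fintype.card ι) ?_ (Filter.Eventually.of_forall fun ω => ?_)) _
    · exact (((hUm p).mul (hUm q).complex_star).mul ((hYm p).mul (hYm q).complex_star)).aestronglyMeasurable
    · rw [norm_mul, norm_mul, norm_mul, norm_star, norm_star]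
      simp only [hU, norm_phaseFactor, one_mul]
      exact mul_le_mul (hYb p ω) (hYb q ω) (norm_nonneg _) (by positivity)
  have hsplit : ∀ p q, ∫ ω, (U p ω * star (U q ω)) * (Y p ω * star (Y q ω)) ∂P =
      (∫ ω, U p ω * star (U q ω) ∂P) * ∫ ω, Y p ω * star (Y q ω) ∂P := by
    intro p q
    set u : T → (Fin L × (Fin C × Fin S) → ℝ) → ℂ := fun p x =>
      Complex.exp (Complex.I * (x (l', p.2) - x (l, p.1) : ℝ)) with hu
    set y : T → (Fin L × (Fin C × Fin S) → ℝ × ℝ) → ℂ := fun p x =>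
      steerInner a (x (l, p.1)) (x (l', p.2)) with hy
    have hum : ∀ p, Measurable (u p) := fun p => by simp only [hu]; fun_prop
    have hym : ∀ p, Measurable (y p) := fun p => by
      refine Finset.measurable_sum _ fun m _ => ?_
      have h1 : Measurable fun x : Fin L × (Fin C × Fin S) → ℝ × ℝ => x (l, p.1) :=
        measurable_pi_apply _
      have h2 : Measurable fun x : Fin L × (Fin C × Fin S) → ℝ × ℝ => x (l', p.2) :=
        measurable_pi_apply _
      exact ((ha m).comp h1).complex_star.mul ((ha m).comp h2)
    exact R.phase_indep_angles.integral_fun_comp_mul_comp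
      (f := fun x => u p x * star (u q x)) (g := fun x => y p x * star (y q x))
      (measurable_pi_lambda _ fun x : Fin L × (Fin C × Fin S) =>
        R.measurable_phase x.1 x.2).aemeasurable
      (measurable_pi_lambda _ fun x : Fin L × (Fin C × Fin S) =>
        R.measurable_angles x.1 x.2).aemeasurable
      ((hum p).mul (hum q).complex_star).aestronglyMeasurable
      ((hym p).mul (hym q).complex_star).aestronglyMeasurable
  have hmain : ((∫ ω, R.interference a l l' ω ∂P : ℝ) : ℂ) =
      ((R.gain l * R.gain l' * ∑ m, ∑ m', ‖antennaCorr a μ ν m m'‖ ^ 2 : ℝ) : ℂ) := by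
    rw [← integral_complex_ofReal]
    simp only [hexp]
    rw [integral_finsetSum _ fun p _ => integrable_finsetSum _ fun q _ => hint p q]
    have hterm : ∀ p, ∫ ω, ∑ q, ((c p * c q : ℝ) : ℂ) *
        ((U p ω * star (U q ω)) * (Y p ω * star (Y q ω))) ∂P =
        ((R.power l p.1 * R.power l' p.2 : ℝ) : ℂ) *
          ∑ m, ∑ m', ((‖antennaCorr a μ ν m m'‖ ^ 2 : ℝ) : ℂ) := by
      intro p
      rw [integral_finsetSum _ fun q _ => hint p q]
      simp only [integral_const_mul, hsplit]
      simp only [hU, R.integral_phaseFactor_mul_star hll', ite_mul, one_mul, zero_mul, mul_ite,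
        mul_zero, Finset.sum_ite_eq, Finset.mem_univ, if_true]
      simp only [hY]
      rw [R.integral_steerInner_mul_star ha ha1 hll']
      congr 2
      simp only [hc]
      rw [mul_mul_mul_comm, Real.mul_self_sqrt (R.power_nonneg _ _),
        Real.mul_self_sqrt (R.power_nonneg _ _)]
    simp only [hterm]
    rw [← Finset.sum_mul, Fintype.sum_prod_type]
    push_cast [gain]
    congr 1
    exact (Finset.sum_mul_sum _ _ _ _).symm
  exact_mod_cast hmain

theorem nmi_eq [IsProbabilityMeasure P] (R : RayModel P μ ν L C S)
    {a : ℝ → ℝ → ι → ℂ} (ha : ∀ m, Measurable fun q : ℝ × ℝ => a q.1 q.2 m)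
    (ha1 : ∀ φ θ m, ‖a φ θ m‖ = 1) {l l' : Fin L} (hll' : l ≠ l') (hl : 0 < R.gain l)
    (hl' : 0 < R.gain l') :
    R.nmi a l l' = 1 / (Fintype.card ι : ℝ) ^ 2 *
      ∑ m, ∑ m', ‖antennaCorr a μ ν m m'‖ ^ 2 := by
  rw [nmi, R.integral_interference ha ha1 hll']
  rw [mul_assoc ((Fintype.card ι : ℝ) ^ 2), mul_comm (R.gain l * R.gain l'),
    mul_div_mul_right _ _ (mul_pos hl hl').ne']
  ring

end RayModel

/-! ### Antenna pairs of the two arrays -/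

/-- The arctangent determines the polar angle of (a, b) only modulo π; ε is the sign lost, that of a
when a ≠ 0. -/
theorem arctanQuot_polar (b a : ℝ) : ∃ ε : ℝ, (ε = 1 ∨ ε = -1) ∧
    ε * (Real.sqrt (a ^ 2 + b ^ 2) * Real.cos (arctanQuot b a)) = a ∧
    ε * (Real.sqrt (a ^ 2 + b ^ 2) * Real.sin (arctanQuot b a)) = b := by
  rcases eq_or_ne a 0 with rfl | ha
  · refine ⟨1, Or.inl rfl, ?_⟩
    have hs : Real.sqrt (0 ^ 2 + b ^ 2) = |b| := by
      rw [zero_pow two_ne_zero, zero_add, Real.sqrt_sq_eq_abs]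
    rw [hs, arctanQuot, if_pos rfl]
    rcases lt_trichotomy b 0 with hb | rfl | hb
    · simp [sign_neg hb, abs_of_neg hb]
    · simp
    · simp [sign_pos hb, abs_of_pos hb]
  · have hpos : 0 < 1 + (b / a) ^ 2 := by positivity
    have hs : Real.sqrt (a ^ 2 + b ^ 2) = |a| * Real.sqrt (1 + (b / a) ^ 2) := by
      rw [← Real.sqrt_sq_eq_abs, ← Real.sqrt_mul (sq_nonneg a)]
      congr 1
      field_simp
    have hne : Real.sqrt (1 + (b / a) ^ 2) ≠ 0 := (Real.sqrt_pos.2 hpos).ne'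
    have h1 : Real.sqrt (a ^ 2 + b ^ 2) * Real.cos (arctanQuot b a) = |a| := by
      rw [hs, arctanQuot, if_neg ha, Real.cos_arctan]
      field_simp
    have h2 : Real.sqrt (a ^ 2 + b ^ 2) * Real.sin (arctanQuot b a) = |a| * (b / a) := by
      rw [hs, arctanQuot, if_neg ha, Real.sin_arctan]
      field_simp
    rw [h1, h2]
    rcases ha.lt_or_gt with h | h
    · refine ⟨-1, Or.inr rfl, ?_, ?_⟩ <;> rw [abs_of_neg h]
      · ring
      · field_simp
    · refine ⟨1, Or.inl rfl, ?_, ?_⟩ <;> rw [abs_of_pos h]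
      · ring
      · field_simp

theorem star_pairResponse (A z₁ z₂ : ℝ) (q : ℝ × ℝ) :
    star (pairResponse A z₁ z₂ q) = pairResponse A (-z₁) (-z₂) q := by
  rw [pairResponse, pairResponse, Complex.star_def, ← Complex.exp_conj, map_mul, Complex.conj_I,
    Complex.conj_ofReal]
  congr 1
  push_cast
  ring

theorem norm_integral_pairResponse_neg (ρ : Measure (ℝ × ℝ)) (A z₁ z₂ : ℝ) :
    ‖∫ q, pairResponse A (-z₁) z₂ q ∂ρ‖ = ‖∫ q, pairResponse A z₁ (-z₂) q ∂ρ‖ := by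
  have h : ∀ q, pairResponse A (-z₁) z₂ q = star (pairResponse A z₁ (-z₂) q) := fun q => by
    rw [star_pairResponse, neg_neg]
  simp only [h]
  rw [← norm_star (∫ q, pairResponse A z₁ (-z₂) q ∂ρ)]
  exact congrArg _ integral_conj

theorem exp_mul_star_exp (x y : ℝ) :
    Complex.exp (Complex.I * x) * star (Complex.exp (Complex.I * y)) =
      Complex.exp (Complex.I * (x - y : ℝ)) := by
  rw [Complex.star_def, ← Complex.exp_conj, map_mul, Complex.conj_I, Complex.conj_ofReal,
    ← Complex.exp_add]
  congr 1
  push_cast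
  ring

theorem steerVURA_mul_star {My Mz : ℕ} (dy dz : ℝ) (m m' : Fin My × Fin Mz) (q : ℝ × ℝ) :
    steerVURA My Mz dy dz q.1 q.2 m * star (steerVURA My Mz dy dz q.1 q.2 m') =
      pairResponse 0 (linZ dy m.1 m'.1) (linZ dz m.2 m'.2) q := by
  rw [steerVURA, steerVURA, steerY, steerY, steerZ, steerZ, star_mul', mul_mul_mul_comm,
    exp_mul_star_exp, exp_mul_star_exp, ← Complex.exp_add, ← mul_add, ← Complex.ofReal_add,
    pairResponse, linZ, linZ, add_zero]
  congr 3
  ring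

/-- The difference of the two cosines is a sin φ + b cos φ = ε√(a²+b²) sin(φ+A). That ε does not
depend on the vertical indices allows these to be swapped later. -/
theorem steerUCylA_mul_star {Mr Mz : ℕ} (dr dz : ℝ) (m m' : Fin Mr) :
    ∃ ε : ℝ, (ε = 1 ∨ ε = -1) ∧ ∀ (k k' : Fin Mz) (q : ℝ × ℝ),
    steerUCylA Mr Mz dr dz q.1 q.2 (m, k) * star (steerUCylA Mr Mz dr dz q.1 q.2 (m', k')) =
      pairResponse (cylA Mr m m') (ε * cylZ₁ Mr dr m m') (linZ dz k k') q := by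
  obtain ⟨ε, hε, hc, hs⟩ := arctanQuot_polar (cylC Mr m m') (cylS Mr m m')
  refine ⟨ε, hε, fun k k' q => ?_⟩
  simp only [steerUCylA, steerCirc, steerZ]
  rw [star_mul', mul_mul_mul_comm,
    exp_mul_star_exp, exp_mul_star_exp, ← Complex.exp_add, ← mul_add, ← Complex.ofReal_add,
    pairResponse, linZ, cylA, cylZ₁, Real.sin_add, Real.cos_sub, Real.cos_sub]
  congr 3
  generalize Real.sqrt (cylS Mr m m' ^ 2 + cylC Mr m m' ^ 2) = ρ at *
  generalize Real.cos (arctanQuot (cylC Mr m m') (cylS Mr m m')) = x at *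
  generalize Real.sin (arctanQuot (cylC Mr m m') (cylS Mr m m')) = y at *
  rw [cylS] at hc
  rw [cylC] at hs
  linear_combination (-(Real.pi * dr / Real.sin (Real.pi / Mr) * Real.sin q.2 * Real.sin q.1)) * hc
    - (Real.pi * dr / Real.sin (Real.pi / Mr) * Real.sin q.2 * Real.cos q.1) * hs

theorem linZ_swap {N : ℕ} (d : ℝ) (m m' : Fin N) : linZ d m' m = -linZ d m m' := by
  unfold linZ; ring

theorem norm_exp_I_mul_ofReal (x : ℝ) : ‖Complex.exp (Complex.I * x)‖ = 1 := by
  rw [mul_comm, Complex.norm_exp_ofReal_mul_I]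

theorem lemma1 {Ω : Type*} [MeasurableSpace Ω] (P : Measure Ω) [IsProbabilityMeasure P]
    (μ ν : Measure ℝ)
    (hν : ν ≪ volume) (hνπ : ∀ᵐ θ ∂ν, θ ∈ Set.Icc 0 Real.pi)
    {L C S : ℕ} (R : RayModel P μ ν L C S) (l l' : Fin L) (hll' : l ≠ l')
    (hl : 0 < R.gain l) (hl' : 0 < R.gain l') :
    (∀ A z₁ z₂ : ℝ, VConverges μ ν A z₁ z₂) ∧
    (∀ (Mr Mz : ℕ) (dr dz : ℝ), 2 ≤ Mr → 1 ≤ Mz →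
      Integrable (R.interference (steerUCylA Mr Mz dr dz) l l') P ∧
      R.nmi (steerUCylA Mr Mz dr dz) l l' =
        1 / ((Mr * Mz : ℕ) : ℝ) ^ 2 *
          ∑ mr : Fin Mr, ∑ mr' : Fin Mr, ∑ mz : Fin Mz, ∑ mz' : Fin Mz,
            ‖vSeries μ ν (cylA Mr mr mr') (cylZ₁ Mr dr mr mr') (linZ dz mz mz')‖ ^ 2) ∧
    (∀ (My Mz : ℕ) (dy dz : ℝ), 1 ≤ My → 1 ≤ Mz →
      Integrable (R.interference (steerVURA My Mz dy dz) l l') P ∧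
      R.nmi (steerVURA My Mz dy dz) l l' =
        1 / ((My * Mz : ℕ) : ℝ) ^ 2 *
          ∑ my : Fin My, ∑ my' : Fin My, ∑ mz : Fin Mz, ∑ mz' : Fin Mz,
            ‖vSeries μ ν 0 (linZ dy my my') (linZ dz mz mz')‖ ^ 2) := by
  -- A positive gain provides a ray, whose angles show that μ and ν are probability measures.
  obtain ⟨r, -, -⟩ := Finset.exists_ne_zero_of_sum_ne_zero hl.ne'
  have hμp : IsProbabilityMeasure μ := by
    rw [← R.azimuth_law l r]
    exact Measure.isProbabilityMeasure_map (R.measurable_azimuth l r).aemeasurable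
  have hνp : IsProbabilityMeasure ν := by
    rw [← R.elevation_law l r]
    exact Measure.isProbabilityMeasure_map (R.measurable_elevation l r).aemeasurable
  have hV := vSeries_eq_integral μ ν hν hνπ
  refine ⟨vConverges μ ν hν hνπ, fun Mr Mz dr dz _ _ => ?_, fun My Mz dy dz _ _ => ?_⟩
  · have ha : ∀ m, Measurable fun q : ℝ × ℝ => steerUCylA Mr Mz dr dz q.1 q.2 m := fun m => by
      unfold steerUCylA steerCirc steerZ
      fun_prop
    have ha1 : ∀ φ θ m, ‖steerUCylA Mr Mz dr dz φ θ m‖ = 1 := fun φ θ m => by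
      rw [steerUCylA, steerCirc, steerZ, norm_mul, norm_exp_I_mul_ofReal, norm_exp_I_mul_ofReal,
        one_mul]
    refine ⟨R.integrable_interference ha ha1 l l', ?_⟩
    rw [R.nmi_eq ha ha1 hll' hl hl', Fintype.card_prod, Fintype.card_fin, Fintype.card_fin]
    congr 1
    rw [Fintype.sum_prod_type]
    refine Finset.sum_congr rfl fun mr _ => ?_
    simp only [Fintype.sum_prod_type]
    rw [Finset.sum_comm]
    refine Finset.sum_congr rfl fun mr' _ => ?_
    obtain ⟨ε, hε, h⟩ := steerUCylA_mul_star (Mz := Mz) dr dz mr mr'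
    simp only [RayModel.antennaCorr, h, hV]
    rcases hε with rfl | rfl
    · simp only [one_mul]
    -- For ε = -1, conjugation moves the sign from z₁ to z₂, and exchanging the two vertical
    -- antennas absorbs it.
    · rw [Finset.sum_comm]
      simp only [neg_one_mul, norm_integral_pairResponse_neg, ← linZ_swap]
  · have ha : ∀ m, Measurable fun q : ℝ × ℝ => steerVURA My Mz dy dz q.1 q.2 m := fun m => by
      unfold steerVURA steerY steerZ
      fun_prop
    have ha1 : ∀ φ θ m, ‖steerVURA My Mz dy dz φ θ m‖ = 1 := fun φ θ m => by
      rw [steerVURA, steerY, steerZ, norm_mul, norm_exp_I_mul_ofReal, norm_exp_I_mul_ofReal,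
        one_mul]
    refine ⟨R.integrable_interference ha ha1 l l', ?_⟩
    rw [R.nmi_eq ha ha1 hll' hl hl', Fintype.card_prod, Fintype.card_fin, Fintype.card_fin]
    congr 1
    rw [Fintype.sum_prod_type]
    refine Finset.sum_congr rfl fun my _ => ?_
    simp only [Fintype.sum_prod_type]
    rw [Finset.sum_comm]
    simp only [RayModel.antennaCorr, steerVURA_mul_star, hV]
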